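/- For $f,g\in L^2(\mathbb R)$ let $\mathcal V_g f(x,\xi)=\int_{\mathbb R} f(t)\,\overline{g(t-x)}\,e^{-2\pi i\xi t}\,dt$, $x,\xi\in\mathbb R$, denote the short-time Fourier transform. For a non-negative $w\in L^1(\mathbb R^2)$ let $C_P(w)\in[0,\infty]$ denote the Poincaré constant of $w$, i.e. the infimum of all finite $C>0$ such that $$\inf_{c\in\mathbb C}\int_{\mathbb R^2}|u(z)-c|^2\,w(z)\,dz\;\le\; C\int_{\mathbb R^2}|\nabla u(z)|^2\,w(z)\,dz$$ for all bounded functions $u\in C^\infty(\mathbb R^2;\mathbb C)$, where $|\nabla u|^2=|\partial_1u|^2+|\partial_2u|^2$ (and $C_P(w)=\infty$ if there is no such $C$). Theorem. Let $g(t)=\exp(t-e^t)$, $t\in\mathbb R$, and let $\gamma:\mathbb R^2\to(0,\infty)$ be integrable and log-concave (that is, $\log\gamma$ is concave). Then the convolution $|\mathcal V_g g|^2\ast\gamma$ converges absolutely at every point, the weight $$w=\left(|\mathcal V_g g|^2\ast\gamma\right)^2$$ is strictly positive, integrable and log-concave, and $C_P(w)<\infty$. -/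

import Mathlib

open MeasureTheory
open scoped ENNReal NNReal ContDiff Convolution

noncomputable section

/-- The short-time Fourier transform of `f` with window `g`:
`V_g f (x, ξ) = ∫ f(t) * conj (g (t - x)) * exp (-2 π i ξ t) dt`, as a function on `ℝ²`,
where `z 0 = x` and `z 1 = ξ`. -/
def stft (g f : ℝ → ℂ) (z : EuclideanSpace ℝ (Fin 2)) : ℂ :=
  ∫ t : ℝ, f t * (starRingEnd ℂ) (g (t - z 0)) *
    Complex.exp (-2 * (Real.pi : ℂ) * Complex.I * (z 1 : ℂ) * (t : ℂ))

/-- The window `g(t) = exp (t - e^t)`. -/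
def expWindow (t : ℝ) : ℂ := (Real.exp (t - Real.exp t) : ℂ)

/-- A non-negative function `f` on `ℝ^d` is log-concave if `log f`, with values in
`ℝ ∪ {-∞}`, is concave: the set where `f` is positive is convex, and on this set `log f`
is a real-valued concave function. -/
def IsLogConcave {d : ℕ} (f : EuclideanSpace ℝ (Fin d) → ℝ) : Prop :=
  (∀ x, 0 ≤ f x) ∧ ConcaveOn ℝ {x | 0 < f x} (fun x => Real.log (f x))

/-- `C_b^∞(ℝ^d)`: the bounded smooth complex-valued functions. -/
def IsSmoothBounded {d : ℕ} (u : EuclideanSpace ℝ (Fin d) → ℂ) : Prop :=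
  ContDiff ℝ ∞ u ∧ ∃ M : ℝ, ∀ x, ‖u x‖ ≤ M

/-- The squared weighted norm `‖u‖²_{L²(w)} = ∫ |u(x)|² w(x) dx` in `[0, ∞]`. -/
def sqNormL2 {d : ℕ} (w : EuclideanSpace ℝ (Fin d) → ℝ)
    (u : EuclideanSpace ℝ (Fin d) → ℂ) : ℝ≥0∞ :=
  ∫⁻ x, ‖u x‖ₑ ^ 2 * ENNReal.ofReal (w x)

/-- `∂_i u`, the `i`-th partial derivative. -/
def partialDeriv {d : ℕ} (i : Fin d) (u : EuclideanSpace ℝ (Fin d) → ℂ)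
    (x : EuclideanSpace ℝ (Fin d)) : ℂ :=
  fderiv ℝ u x (EuclideanSpace.single i 1)

/-- `‖∇u‖²_{L²(w)} = ∫ ∑ i, |∂_i u(x)|² w(x) dx` in `[0, ∞]`. -/
def sqNormGradL2 {d : ℕ} (w : EuclideanSpace ℝ (Fin d) → ℝ)
    (u : EuclideanSpace ℝ (Fin d) → ℂ) : ℝ≥0∞ :=
  ∫⁻ x, (∑ i, ‖partialDeriv i u x‖ₑ ^ 2) * ENNReal.ofReal (w x)

/-- The weights `v, w` satisfy the Poincaré inequality with the finite constant `C`. -/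
def PoincareInequality {d : ℕ} (v w : EuclideanSpace ℝ (Fin d) → ℝ) (C : ℝ≥0) : Prop :=
  ∀ u : EuclideanSpace ℝ (Fin d) → ℂ, IsSmoothBounded u →
    (⨅ c : ℂ, sqNormL2 v (fun x => u x - c)) ≤ (C : ℝ≥0∞) * sqNormGradL2 w u

/-- The Poincaré constant `C_P(v, w)`: the infimum in `[0, ∞]` of all finite `C > 0` for which
the Poincaré inequality holds; it is `∞` if there is none. -/
def poincareConst {d : ℕ} (v w : EuclideanSpace ℝ (Fin d) → ℝ) : ℝ≥0∞ :=
  ⨅ (C : ℝ≥0) (_ : 0 < C ∧ PoincareInequality v w C), (C : ℝ≥0∞)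

/-- `|F|²` for a function `F` on `ℝ²`. -/
def sqModulus (F : EuclideanSpace ℝ (Fin 2) → ℂ) (z : EuclideanSpace ℝ (Fin 2)) : ℝ :=
  ‖F z‖ ^ 2

/-- The weight `w = (|F|² ∗ γ)²`, where `∗` is convolution with respect to Lebesgue measure. -/
def smoothedWeight (F : EuclideanSpace ℝ (Fin 2) → ℂ) (γ : EuclideanSpace ℝ (Fin 2) → ℝ)
    (z : EuclideanSpace ℝ (Fin 2)) : ℝ :=
  ((sqModulus F ⋆[ContinuousLinearMap.mul ℝ ℝ, volume] γ) z) ^ 2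

end

/-!
The spectrogram of the window `g(t) = exp (t - e^t)` is explicit: the substitution `s = e^t` gives
`|V_g g(x, ξ)|² = (e^{-x} / (1 + e^{-x})²)² |Γ(2 + 2πiξ)|²`
(`sqModulus_stft_expWindow`). The first factor is log-concave by inspection. For the second, the
reflection formula gives `|Γ(2 + iy)|² = (1 + y²) πy / sinh (πy)` for `y > 0`, and the elementary
bound `sinh a ≥ a + a³ / 6` makes the second derivative of its logarithm nonpositive; as the
function is even and antitone on `[0, ∞)`, it is log-concave on the line
(`concaveOn_log_gammaProfile`). Hence the spectrogram is a positive, integrable and log-concave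
function that vanishes at infinity.

Let `W` be its convolution with `γ`. It is log-concave by the Prékopa–Leindler inequality in the
plane (`prekopa_leindler_plane`), which is obtained by induction on the dimension from the
Brunn–Minkowski inequality on the line; it is bounded and integrable since the spectrogram is; and
it vanishes at infinity by dominated convergence. All of this passes to `w = W²`.

It remains to see that a positive log-concave weight `w` on the plane that vanishes at infinity has
a finite Poincaré constant (`poincareConst_lt_top_of_concaveOn_log`). If `w ≤ e⁻² w(0)` outside the
disc of radius `R`, then concavity of `log w` makes `w` decay exponentially along each ray beyond
that disc, at a rate that depends only on `R`. In polar coordinates, a Hardy inequality along the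
rays (`setLIntegral_Ici_hardy`) bounds `∫ |u - c|² w` by the integral over the disc of radius `2R`
and the Dirichlet integral. This disc lies in a square, where `w` is bounded above and below and
the Poincaré inequality for Lebesgue measure applies (`lintegral_square_sq_enorm_sub_le`).
-/

/-! ### The spectrogram of the window `exp (t - e^t)` -/

/-- The profile in time of the spectrogram of `expWindow`; it is `(4 cosh² (x / 2))⁻²`. -/
noncomputable def timeProfile (x : ℝ) : ℝ := (Real.exp (-x) / (1 + Real.exp (-x)) ^ 2) ^ 2

/-- The profile in frequency, `|Γ(2 + iy)|²`, of the spectrogram of `expWindow`. -/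
noncomputable def gammaProfile (y : ℝ) : ℝ := ‖Complex.Gamma (2 + y * Complex.I)‖ ^ 2

theorem integral_comp_exp {E : Type*} [NormedAddCommGroup E] [NormedSpace ℝ E] (f : ℝ → E) :
    ∫ t : ℝ, Real.exp t • f (Real.exp t) = ∫ s in Set.Ioi 0, f s := by
  have h := integral_image_eq_integral_abs_deriv_smul MeasurableSet.univ
    (fun x _ => (Real.hasDerivAt_exp x).hasDerivWithinAt)
    (fun x _ y _ hxy => Real.exp_injective hxy) f
  rw [Set.image_univ, Real.range_exp] at h
  simpa [abs_of_pos (Real.exp_pos _)] using h.symm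

/-- The substitution `s = e^t` turns the short-time Fourier transform into a Gamma integral. -/
theorem stft_expWindow (z : EuclideanSpace ℝ (Fin 2)) :
    stft expWindow expWindow z = Complex.exp (-(z 0 : ℂ)) *
      ((1 / ((1 + Real.exp (-(z 0)) : ℝ) : ℂ)) ^ (2 + ((-2 * Real.pi * z 1 : ℝ) : ℂ) * Complex.I) *
        Complex.Gamma (2 + ((-2 * Real.pi * z 1 : ℝ) : ℂ) * Complex.I)) := by
  set a : ℂ := 2 + ((-2 * Real.pi * z 1 : ℝ) : ℂ) * Complex.I with ha
  have hr : 0 < 1 + Real.exp (-(z 0)) := by positivity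
  have hare : 0 < a.re := by simp [ha]
  rw [← Complex.integral_cpow_mul_exp_neg_mul_Ioi hare hr, ← integral_const_mul,
    ← integral_comp_exp, stft]
  congr 1
  funext t
  have hs : ((Real.exp t : ℝ) : ℂ) ^ (a - 1) = Complex.exp ((a - 1) * t) := by
    rw [Complex.cpow_def_of_ne_zero (by exact_mod_cast (Real.exp_pos t).ne'),
      ← Complex.ofReal_log (Real.exp_pos t).le, Real.log_exp, mul_comm]
  rw [hs]
  simp only [expWindow, Complex.conj_ofReal, Complex.real_smul, ha]
  push_cast
  simp only [← Complex.exp_add]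
  congr 1
  have : Complex.exp ((t : ℂ) - z 0) = Complex.exp t * Complex.exp (-(z 0 : ℂ)) := by
    rw [← Complex.exp_add]; congr 1
  rw [this]
  ring

theorem sqModulus_stft_expWindow (z : EuclideanSpace ℝ (Fin 2)) :
    sqModulus (stft expWindow expWindow) z =
      timeProfile (z 0) * gammaProfile (-2 * Real.pi * z 1) := by
  have hr : 0 < 1 / (1 + Real.exp (-(z 0))) := by positivity
  have h1 : ‖(1 / ((1 + Real.exp (-(z 0)) : ℝ) : ℂ)) ^
      (2 + ((-2 * Real.pi * z 1 : ℝ) : ℂ) * Complex.I)‖ = (1 / (1 + Real.exp (-(z 0)))) ^ 2 := by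
    have : (1 / ((1 + Real.exp (-(z 0)) : ℝ) : ℂ)) = ((1 / (1 + Real.exp (-(z 0))) : ℝ) : ℂ) := by
      push_cast; rfl
    rw [this, Complex.norm_cpow_eq_rpow_re_of_pos hr, ← Real.rpow_natCast]
    congr 1
    simp
  rw [sqModulus, stft_expWindow, norm_mul, norm_mul, h1, Complex.norm_exp, timeProfile,
    gammaProfile]
  simp only [Complex.neg_re, Complex.ofReal_re]
  field_simp

/-! ### The profile in time -/

theorem timeProfile_pos (x : ℝ) : 0 < timeProfile x := by
  unfold timeProfile; positivity

theorem one_add_sq_div_two_le_cosh (x : ℝ) : 1 + x ^ 2 / 2 ≤ Real.cosh x := by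
  have h1 : Real.cosh x = 1 + 2 * Real.sinh (x / 2) ^ 2 := by
    have h := Real.cosh_two_mul (x / 2)
    have h' := Real.cosh_sq (x / 2)
    rw [mul_div_cancel₀ x (two_ne_zero)] at h
    linarith
  have h2 : (x / 2) ^ 2 ≤ Real.sinh (x / 2) ^ 2 := by
    rw [← sq_abs, ← sq_abs (Real.sinh _), Real.abs_sinh]
    gcongr
    exact Real.self_le_sinh_iff.2 (abs_nonneg _)
  rw [h1]
  linarith

theorem timeProfile_le (x : ℝ) : timeProfile x ≤ (1 + x ^ 2)⁻¹ := by
  have h : Real.exp (-x) / (1 + Real.exp (-x)) ^ 2 = (2 * Real.cosh x + 2)⁻¹ := by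
    rw [Real.cosh_eq, Real.exp_neg]
    have := Real.exp_pos x
    field_simp
    ring
  have h2 : (2 * Real.cosh x + 2)⁻¹ ≤ (1 + x ^ 2)⁻¹ := by
    exact inv_anti₀ (by positivity) (by linarith [one_add_sq_div_two_le_cosh x])
  have h3 : (1 + x ^ 2)⁻¹ ≤ 1 := inv_le_one_of_one_le₀ (by nlinarith [sq_nonneg x])
  have h0 : 0 ≤ (1 + x ^ 2)⁻¹ := by positivity
  rw [timeProfile, h]
  calc ((2 * Real.cosh x + 2)⁻¹) ^ 2 ≤ ((1 + x ^ 2)⁻¹) ^ 2 := by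
        have := Real.cosh_pos x
        gcongr
    _ ≤ (1 + x ^ 2)⁻¹ := by nlinarith

theorem concaveOn_log_timeProfile : ConcaveOn ℝ Set.univ fun x => Real.log (timeProfile x) := by
  have hd (x : ℝ) : HasDerivAt (fun x => Real.log (timeProfile x))
      (-2 + 4 / (Real.exp x + 1)) x := by
    have heq : (fun x => Real.log (timeProfile x)) =
        fun x => 2 * (-x - 2 * Real.log (1 + Real.exp (-x))) := by
      funext x
      have : 0 < 1 + Real.exp (-x) := by positivity
      rw [timeProfile, Real.log_pow, Real.log_div (Real.exp_ne_zero _) (by positivity),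
        Real.log_exp, Real.log_pow]
      push_cast; ring
    rw [heq]
    have hpos : 1 + Real.exp (-x) ≠ 0 := by positivity
    have h1 : HasDerivAt (fun x : ℝ => Real.exp (-x)) (-Real.exp (-x)) x := by
      simpa using (hasDerivAt_neg x).exp
    have h2 := (((hasDerivAt_neg x).sub (((h1.const_add 1).log hpos).const_mul 2)).const_mul 2)
    refine h2.congr_deriv ?_
    rw [Real.exp_neg]
    have := Real.exp_pos x
    field_simp
    ring
  refine Antitone.concaveOn_univ_of_deriv (fun x => (hd x).differentiableAt) ?_
  rw [show deriv (fun x => Real.log (timeProfile x)) = fun x => -2 + 4 / (Real.exp x + 1) from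
    funext fun x => (hd x).deriv]
  intro x y hxy
  have := Real.exp_le_exp.2 hxy
  simp only
  gcongr

/-! ### The profile in frequency -/

theorem two_add_mul_I_ne (y : ℝ) (m : ℕ) : (2 + y * Complex.I : ℂ) ≠ -m := by
  intro h
  have := congrArg Complex.re h
  simp at this
  have hm : (0 : ℝ) ≤ m := m.cast_nonneg
  linarith

theorem gammaProfile_pos (y : ℝ) : 0 < gammaProfile y := by
  have := Complex.Gamma_ne_zero (two_add_mul_I_ne y)
  unfold gammaProfile
  positivity

theorem continuous_gammaProfile : Continuous gammaProfile := by
  unfold gammaProfile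
  refine (continuous_iff_continuousAt.2 fun y => ?_).norm.pow 2
  have h1 := (Complex.differentiableAt_Gamma _ (two_add_mul_I_ne y)).continuousAt
  exact ContinuousAt.comp (f := fun y : ℝ => (2 + y * Complex.I : ℂ)) h1 (by fun_prop)

theorem norm_Gamma_le {s : ℂ} (hs : 0 < s.re) : ‖Complex.Gamma s‖ ≤ Real.Gamma s.re := by
  rw [Complex.Gamma_eq_integral hs, Complex.GammaIntegral, Real.Gamma_eq_integral hs]
  refine norm_integral_le_of_norm_le (Real.GammaIntegral_convergent hs) ?_
  filter_upwards [ae_restrict_mem measurableSet_Ioi] with x hx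
  rw [norm_mul, Complex.norm_cpow_eq_rpow_re_of_pos hx, Complex.norm_real,
    Real.norm_of_nonneg (Real.exp_pos _).le]
  simp

/-- The decay comes from `Γ(2 + iy) = Γ(3 + iy) / (2 + iy)` and `|Γ(3 + iy)| ≤ Γ(3) = 2`. -/
theorem gammaProfile_le (y : ℝ) : gammaProfile y ≤ 4 * (1 + y ^ 2)⁻¹ := by
  have hne : (2 + y * Complex.I : ℂ) ≠ 0 := by simpa using two_add_mul_I_ne y 0
  have h1 := Complex.Gamma_add_one _ hne
  have h2 : ‖Complex.Gamma (2 + y * Complex.I + 1)‖ ≤ 2 := by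
    have hre : (2 + y * Complex.I + 1 : ℂ).re = 3 := by simp; norm_num
    refine (norm_Gamma_le (by rw [hre]; norm_num)).trans ?_
    rw [hre, Real.Gamma_ofNat_eq_factorial]
    norm_num [Nat.factorial]
  have h3 : ‖(2 + y * Complex.I : ℂ)‖ ^ 2 = 4 + y ^ 2 := by
    rw [← Complex.normSq_eq_norm_sq, Complex.normSq_apply]
    simp; ring
  rw [h1, norm_mul] at h2
  have h4 : (4 + y ^ 2) * gammaProfile y ≤ 4 := by
    rw [gammaProfile, ← h3, ← mul_pow]
    calc _ ≤ (2 : ℝ) ^ 2 := by gcongr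
      _ = 4 := by norm_num
  rw [← div_eq_mul_inv, le_div_iff₀ (by positivity)]
  nlinarith [gammaProfile_pos y]

theorem gammaProfile_neg (y : ℝ) : gammaProfile (-y) = gammaProfile y := by
  have : (2 + ((-y : ℝ) : ℂ) * Complex.I) = (starRingEnd ℂ) (2 + y * Complex.I) := by
    simp [map_ofNat]
  rw [gammaProfile, this, Complex.Gamma_conj, RCLike.norm_conj, gammaProfile]

/-- The reflection formula gives the modulus of `Γ` on the line `Re s = 2`. -/
theorem gammaProfile_eq {y : ℝ} (hy : 0 < y) :
    gammaProfile y = (1 + y ^ 2) * (Real.pi * y) / Real.sinh (Real.pi * y) := by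
  have hI : (y * Complex.I : ℂ) ≠ 0 := by simp [hy.ne']
  have hI1 : (1 + y * Complex.I : ℂ) ≠ 0 := by
    intro h; have := congrArg Complex.re h; simp at this
  have hI2 : (1 - y * Complex.I : ℂ) ≠ 0 := by
    intro h; have := congrArg Complex.re h; simp at this
  have hs : Real.sinh (Real.pi * y) ≠ 0 := (Real.sinh_pos_iff.2 (by positivity)).ne'
  have e1 : Complex.Gamma (2 + y * Complex.I) =
      (1 + y * Complex.I) * (y * Complex.I * Complex.Gamma (y * Complex.I)) := by
    rw [← Complex.Gamma_add_one _ hI, add_comm _ (1 : ℂ), ← Complex.Gamma_add_one _ hI1]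
    congr 1; ring
  have e2 : (starRingEnd ℂ) (Complex.Gamma (2 + y * Complex.I)) =
      (1 - y * Complex.I) * Complex.Gamma (1 - y * Complex.I) := by
    rw [← Complex.Gamma_conj, ← Complex.Gamma_add_one _ hI2]
    congr 1
    simp [map_ofNat]; ring
  have e3 := Complex.Gamma_mul_Gamma_one_sub (y * Complex.I)
  have e4 : Complex.sin (Real.pi * (y * Complex.I)) =
      Complex.sinh ((Real.pi * y : ℝ) : ℂ) * Complex.I := by
    rw [← mul_assoc, Complex.sin_mul_I]; push_cast; rfl
  rw [e4, ← Complex.ofReal_sinh] at e3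
  have hs' : ((Real.sinh (Real.pi * y) : ℝ) : ℂ) ≠ 0 := by exact_mod_cast hs
  have key : ((gammaProfile y : ℝ) : ℂ) =
      (((1 + y ^ 2) * (Real.pi * y) / Real.sinh (Real.pi * y) : ℝ) : ℂ) := by
    rw [gammaProfile]
    push_cast
    rw [← Complex.mul_conj', e2, e1]
    calc _ = (1 - (y * Complex.I) ^ 2) * (y * Complex.I) *
          (Complex.Gamma (y * Complex.I) * Complex.Gamma (1 - y * Complex.I)) := by ring
      _ = _ := by
        rw [e3, mul_pow, Complex.I_sq]
        push_cast at hs' ⊢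
        field_simp
        ring
  exact_mod_cast key

theorem add_cube_div_six_le_sinh {x : ℝ} (hx : 0 ≤ x) : x + x ^ 3 / 6 ≤ Real.sinh x := by
  have hd (x : ℝ) : HasDerivAt (fun x => Real.sinh x - (x + x ^ 3 / 6))
      (Real.cosh x - (1 + x ^ 2 / 2)) x := by
    refine ((Real.hasDerivAt_sinh x).sub
      ((hasDerivAt_id x).add ((hasDerivAt_pow 3 x).div_const 6))).congr_deriv ?_
    push_cast; ring
  have hm : Monotone fun x => Real.sinh x - (x + x ^ 3 / 6) :=
    monotone_of_deriv_nonneg (fun x => (hd x).differentiableAt) fun x => by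
      rw [(hd x).deriv]; linarith [one_add_sq_div_two_le_cosh x]
  have := hm hx
  simp at this
  linarith

theorem six_lt_pi_sq : 6 < Real.pi ^ 2 := by nlinarith [Real.pi_gt_three]

theorem pi_mul_mul_one_add_sq_le_sinh {y : ℝ} (hy : 0 ≤ y) :
    Real.pi * y * (1 + y ^ 2) ≤ Real.sinh (Real.pi * y) := by
  have h := add_cube_div_six_le_sinh (mul_nonneg Real.pi_pos.le hy)
  have h2 : 0 ≤ Real.pi * y ^ 3 * (Real.pi ^ 2 - 6) := by
    have := six_lt_pi_sq
    have := Real.pi_pos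
    have : 0 ≤ Real.pi ^ 2 - 6 := by linarith
    positivity
  nlinarith

/-- The logarithmic derivative of `|Γ(2 + iy)|²` is nonpositive for `y > 0`, in terms of
`a = π y`. -/
theorem mul_sinh_le_mul_cosh {a : ℝ} (ha : 0 ≤ a) :
    (Real.pi ^ 2 + 3 * a ^ 2) * Real.sinh a ≤ a * (Real.pi ^ 2 + a ^ 2) * Real.cosh a := by
  have hd (x : ℝ) : HasDerivAt
      (fun a => a * (Real.pi ^ 2 + a ^ 2) * Real.cosh a - (Real.pi ^ 2 + 3 * a ^ 2) * Real.sinh a)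
      (x * Real.sinh x * (Real.pi ^ 2 + x ^ 2 - 6)) x := by
    have h2 := (hasDerivAt_pow 2 x)
    refine ((((hasDerivAt_id x).mul (h2.const_add (Real.pi ^ 2))).mul
      (Real.hasDerivAt_cosh x)).sub
      (((h2.const_mul 3).const_add (Real.pi ^ 2)).mul (Real.hasDerivAt_sinh x))).congr_deriv ?_
    simp; ring
  have hm := monotoneOn_of_deriv_nonneg (convex_Ici (0 : ℝ))
    (fun x _ => (hd x).continuousAt.continuousWithinAt)
    (fun x _ => (hd x).differentiableAt.differentiableWithinAt) (fun x hx => by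
      rw [(hd x).deriv]
      rw [interior_Ici] at hx
      have h0 : 0 < x := hx
      have h1 := Real.sinh_pos_iff.2 h0
      have h6 : 0 < Real.pi ^ 2 + x ^ 2 - 6 := by nlinarith [six_lt_pi_sq]
      positivity)
  have := hm Set.self_mem_Ici ha ha
  simp at this
  linarith

theorem log_gammaProfile_eq {y : ℝ} (hy : 0 < y) : Real.log (gammaProfile y) =
    Real.log (1 + y ^ 2) + Real.log (Real.pi * y) - Real.log (Real.sinh (Real.pi * y)) := by
  have hs : 0 < Real.sinh (Real.pi * y) := Real.sinh_pos_iff.2 (by positivity)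
  rw [gammaProfile_eq hy, Real.log_div (by positivity) hs.ne',
    Real.log_mul (by positivity) (by positivity)]

theorem hasDerivAt_log_gammaProfile {y : ℝ} (hy : 0 < y) :
    HasDerivAt (fun y => Real.log (gammaProfile y))
      (2 * y / (1 + y ^ 2) + 1 / y -
        Real.pi * Real.cosh (Real.pi * y) / Real.sinh (Real.pi * y)) y := by
  have hs : 0 < Real.sinh (Real.pi * y) := Real.sinh_pos_iff.2 (by positivity)
  have hpy : Real.pi * y ≠ 0 := by positivity
  have hlin : HasDerivAt (fun y => Real.pi * y) Real.pi y := by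
    simpa using (hasDerivAt_id y).const_mul Real.pi
  have h := (((hasDerivAt_pow 2 y).const_add 1).log (by positivity)).add
    (hlin.log hpy) |>.sub (hlin.sinh.log hs.ne')
  refine (h.congr_of_eventuallyEq ?_).congr_deriv ?_
  · filter_upwards [lt_mem_nhds hy] with x hx
    simpa using log_gammaProfile_eq hx
  · field_simp
    push_cast
    ring

theorem concaveOn_Ici_log_gammaProfile :
    ConcaveOn ℝ (Set.Ici 0) fun y => Real.log (gammaProfile y) := by
  refine concaveOn_of_hasDerivWithinAt2_nonpos (convex_Ici 0)
    (f' := fun y => 2 * y / (1 + y ^ 2) + 1 / y -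
        Real.pi * Real.cosh (Real.pi * y) / Real.sinh (Real.pi * y))
    (f'' := fun y => 2 * (1 - y ^ 2) / (1 + y ^ 2) ^ 2 - 1 / y ^ 2 +
      Real.pi ^ 2 / Real.sinh (Real.pi * y) ^ 2)
    (continuous_gammaProfile.log fun y => (gammaProfile_pos y).ne').continuousOn ?_ ?_ ?_
  · intro y hy
    rw [interior_Ici] at hy
    exact (hasDerivAt_log_gammaProfile hy).hasDerivWithinAt
  · intro y hy
    rw [interior_Ici] at hy
    have hy : 0 < y := hy
    have hs : 0 < Real.sinh (Real.pi * y) := Real.sinh_pos_iff.2 (by positivity)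
    have hlin : HasDerivAt (fun y => Real.pi * y) Real.pi y := by
      simpa using (hasDerivAt_id y).const_mul Real.pi
    have h := ((((hasDerivAt_id y).const_mul 2).div ((hasDerivAt_pow 2 y).const_add 1)
      (by positivity)).add ((hasDerivAt_const y (1 : ℝ)).div (hasDerivAt_id y) hy.ne')).sub
      ((hlin.cosh.const_mul Real.pi).div hlin.sinh hs.ne')
    refine (h.congr_deriv ?_).hasDerivWithinAt
    have hcs := Real.cosh_sq (Real.pi * y)
    have : Real.pi * (Real.sinh (Real.pi * y) * Real.pi) * Real.sinh (Real.pi * y) -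
        Real.pi * Real.cosh (Real.pi * y) * (Real.cosh (Real.pi * y) * Real.pi) =
        - Real.pi ^ 2 := by linear_combination (- Real.pi ^ 2) * hcs
    simp only [id]
    rw [this]
    field_simp
    simp
    ring
  · intro y hy
    rw [interior_Ici] at hy
    have hy : 0 < y := hy
    have h1 := pi_mul_mul_one_add_sq_le_sinh hy.le
    have h2 : Real.pi ^ 2 / Real.sinh (Real.pi * y) ^ 2 ≤
        Real.pi ^ 2 / (Real.pi * y * (1 + y ^ 2)) ^ 2 := by
      gcongr
    have h3 : 2 * (1 - y ^ 2) / (1 + y ^ 2) ^ 2 - 1 / y ^ 2 +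
        Real.pi ^ 2 / (Real.pi * y * (1 + y ^ 2)) ^ 2 = - (3 * y ^ 2 / (1 + y ^ 2) ^ 2) := by
      field_simp
      ring
    have h4 : 0 ≤ 3 * y ^ 2 / (1 + y ^ 2) ^ 2 := by positivity
    linarith

theorem antitoneOn_log_gammaProfile :
    AntitoneOn (fun y => Real.log (gammaProfile y)) (Set.Ici 0) := by
  refine antitoneOn_of_deriv_nonpos (convex_Ici 0)
    (continuous_gammaProfile.log fun y => (gammaProfile_pos y).ne').continuousOn ?_ ?_
  · intro y hy
    rw [interior_Ici] at hy
    exact (hasDerivAt_log_gammaProfile hy).differentiableAt.differentiableWithinAt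
  · intro y hy
    rw [interior_Ici] at hy
    have hy : 0 < y := hy
    rw [(hasDerivAt_log_gammaProfile hy).deriv]
    have hs : 0 < Real.sinh (Real.pi * y) := Real.sinh_pos_iff.2 (by positivity)
    have h := mul_sinh_le_mul_cosh (mul_nonneg Real.pi_pos.le hy.le)
    have hpi := Real.pi_pos
    have e : 2 * y / (1 + y ^ 2) + 1 / y -
        Real.pi * Real.cosh (Real.pi * y) / Real.sinh (Real.pi * y) =
        ((Real.pi ^ 2 + 3 * (Real.pi * y) ^ 2) * Real.sinh (Real.pi * y) -
          Real.pi * y * (Real.pi ^ 2 + (Real.pi * y) ^ 2) * Real.cosh (Real.pi * y)) /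
        (Real.pi ^ 2 * y * (1 + y ^ 2) * Real.sinh (Real.pi * y)) := by
      field_simp
      ring
    rw [e]
    exact div_nonpos_of_nonpos_of_nonneg (by linarith) (by positivity)

theorem concaveOn_log_gammaProfile :
    ConcaveOn ℝ Set.univ fun y => Real.log (gammaProfile y) := by
  have habs (y : ℝ) : gammaProfile |y| = gammaProfile y := by
    rcases abs_choice y with h | h <;> rw [h]
    exact gammaProfile_neg y
  refine ⟨convex_univ, fun x _ y _ a b ha hb hab => ?_⟩
  have h1 := concaveOn_Ici_log_gammaProfile.2 (abs_nonneg x) (abs_nonneg y) ha hb hab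
  have h2 : |a • x + b • y| ≤ a • |x| + b • |y| := by
    refine (abs_add_le _ _).trans ?_
    simp [abs_mul, abs_of_nonneg ha, abs_of_nonneg hb]
  have h3 := antitoneOn_log_gammaProfile (Set.mem_Ici.2 (abs_nonneg _))
    (Set.mem_Ici.2 ((abs_nonneg _).trans h2)) h2
  simp only [habs] at h1 h3
  exact h1.trans h3

/-! ### The Brunn–Minkowski inequality on the line -/

theorem volume_add_volume_le_of_isCompact {K L C : Set ℝ} (hK : IsCompact K) (hL : IsCompact L)
    (hK0 : K.Nonempty) (hL0 : L.Nonempty) (h : ∀ x ∈ K, ∀ y ∈ L, x + y ∈ C) :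
    volume K + volume L ≤ volume C := by
  -- `K` and `L` are translated so that they meet only in the point `sSup K + sInf L`.
  set p := sSup K
  set q := sInf L
  have hp : p ∈ K := hK.sSup_mem hK0
  have hq : q ∈ L := hL.sInf_mem hL0
  have e1 : volume ((fun x => x - q) ⁻¹' K) = volume K := by
    simpa only [sub_eq_add_neg] using measure_preimage_add_right volume (-q) K
  have e2 : volume ((fun x => x - p) ⁻¹' L) = volume L := by
    simpa only [sub_eq_add_neg] using measure_preimage_add_right volume (-p) L
  have hm : MeasurableSet ((fun x => x - p) ⁻¹' L) :=
    (measurable_id.sub_const p) hL.measurableSet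
  have hd : AEDisjoint volume ((fun x => x - q) ⁻¹' K) ((fun x => x - p) ⁻¹' L) := by
    refine measure_mono_null (t := {p + q}) (fun x hx => ?_) (measure_singleton _)
    have h1 : x - q ≤ p := le_csSup hK.bddAbove hx.1
    have h2 : q ≤ x - p := csInf_le hL.bddBelow hx.2
    exact le_antisymm (by linarith) (by linarith)
  rw [← e1, ← e2, ← measure_union₀ hm.nullMeasurableSet hd]
  refine measure_mono ?_
  rintro x (hx | hx)
  · simpa using h _ hx _ hq
  · simpa using h _ hp _ hx

/-- The Brunn–Minkowski inequality on the line: `C` contains the Minkowski sum of `A` and `B`. -/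
theorem volume_add_volume_le {A B C : Set ℝ} (hA : MeasurableSet A) (hB : MeasurableSet B)
    (hA0 : A.Nonempty) (hB0 : B.Nonempty) (h : ∀ x ∈ A, ∀ y ∈ B, x + y ∈ C) :
    volume A + volume B ≤ volume C := by
  have key : ∀ (K : Set ℝ) (_ : K.Nonempty ∧ IsCompact K ∧ K ⊆ A) (L : Set ℝ)
      (_ : L.Nonempty ∧ IsCompact L ∧ L ⊆ B), volume K + volume L ≤ volume C :=
    fun K hK L hL => volume_add_volume_le_of_isCompact hK.2.1 hL.2.1 hK.1 hL.1
      fun x hx y hy => h x (hK.2.2 hx) y (hL.2.2 hy)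
  have hsup : ∀ {S : Set ℝ}, MeasurableSet S → S.Nonempty → ∀ {c d : ℝ≥0∞},
      (∀ K : Set ℝ, K.Nonempty ∧ IsCompact K ∧ K ⊆ S → volume K + c ≤ d) →
      volume S + c ≤ d := by
    intro S hS hS0 c d hK
    obtain ⟨s, hs⟩ := hS0
    have h0 : c ≤ d := le_trans (by simp)
      (hK {s} ⟨Set.singleton_nonempty s, isCompact_singleton, by simpa using hs⟩)
    rcases eq_or_ne c ⊤ with rfl | hc
    · simp only [top_le_iff] at h0
      simp [h0]
    refine le_of_le_of_eq (add_le_add_left (b := volume S) (c := d - c) ?_ c)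
      (tsub_add_cancel_of_le h0)
    rw [hS.measure_eq_iSup_isCompact]
    refine iSup₂_le fun K hKS => iSup_le fun hKc => ?_
    rcases K.eq_empty_or_nonempty with rfl | hne
    · simp
    · exact ENNReal.le_sub_of_add_le_right hc (hK K ⟨hne, hKc, hKS⟩)
  refine hsup hA hA0 fun K hK => ?_
  rw [add_comm]
  refine hsup hB hB0 fun L hL => ?_
  rw [add_comm]
  exact key K hK L hL

open scoped Pointwise in
theorem ofReal_mul_volume_add_le {A B C : Set ℝ} {a b : ℝ} (ha : 0 < a) (hb : 0 < b)
    (hA : MeasurableSet A) (hB : MeasurableSet B)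
    (hA0 : A.Nonempty) (hB0 : B.Nonempty) (h : ∀ x ∈ A, ∀ y ∈ B, a * x + b * y ∈ C) :
    ENNReal.ofReal a * volume A + ENNReal.ofReal b * volume B ≤ volume C := by
  have hv : ∀ {c : ℝ}, 0 < c → ∀ S : Set ℝ, ENNReal.ofReal c * volume S = volume (c • S) := by
    intro c hc S
    rw [Measure.addHaar_smul]
    simp [abs_of_pos hc]
  rw [hv ha, hv hb]
  refine volume_add_volume_le (hA.const_smul₀ a) (hB.const_smul₀ b) hA0.smul_set hB0.smul_set ?_
  rintro _ ⟨x, hx, rfl⟩ _ ⟨y, hy, rfl⟩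
  exact h x hx y hy

/-! ### The Prékopa–Leindler inequality -/

theorem ENNReal.rpow_mul_rpow_le_add {a b : ℝ} (ha : 0 < a) (hb : 0 < b) (hab : a + b = 1)
    (x y : ℝ≥0∞) : x ^ a * y ^ b ≤ ENNReal.ofReal a * x + ENNReal.ofReal b * y := by
  have hpq : (a⁻¹).HolderConjugate b⁻¹ := by
    rw [Real.holderConjugate_iff]
    exact ⟨(one_lt_inv₀ ha).2 (by linarith), by simpa using hab⟩
  have h := ENNReal.young_inequality (x ^ a) (y ^ b) hpq
  rw [← ENNReal.rpow_mul, ← ENNReal.rpow_mul, mul_inv_cancel₀ ha.ne', mul_inv_cancel₀ hb.ne',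
    ENNReal.rpow_one, ENNReal.rpow_one, ENNReal.ofReal_inv_of_pos ha, ENNReal.ofReal_inv_of_pos hb,
    div_eq_mul_inv, div_eq_mul_inv, inv_inv, inv_inv, mul_comm x, mul_comm y] at h
  exact h

/-- The layer cake formula for a function with values in `[0, 1]`. -/
theorem lintegral_eq_setLIntegral_Ioo_volume {f : ℝ → ℝ≥0∞} (hf : Measurable f)
    (hf1 : ∀ x, f x ≤ 1) :
    ∫⁻ x, f x = ∫⁻ t in Set.Ioo (0 : ℝ) 1, volume {x | ENNReal.ofReal t < f x} := by
  have hne (x : ℝ) : f x ≠ ⊤ := ((hf1 x).trans_lt ENNReal.one_lt_top).ne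
  have h := lintegral_eq_lintegral_meas_lt (f := fun x => (f x).toReal) volume
    (Filter.Eventually.of_forall fun x => ENNReal.toReal_nonneg) hf.ennreal_toReal.aemeasurable
  simp only [ENNReal.ofReal_toReal (hne _)] at h
  have hset (t : ℝ) (ht : 0 < t) : {x | t < (f x).toReal} = {x | ENNReal.ofReal t < f x} := by
    ext x
    exact (ENNReal.ofReal_lt_iff_lt_toReal ht.le (hne x)).symm
  rw [h, ← Set.Ioo_union_Ici_eq_Ioi (zero_lt_one' ℝ), lintegral_union measurableSet_Ici
    (Set.disjoint_left.2 fun x hx hx' => hx.2.not_ge hx'),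
    setLIntegral_congr_fun measurableSet_Ioo (fun t ht => by rw [hset t ht.1]),
    setLIntegral_congr_fun (g := fun _ => 0) measurableSet_Ici (fun t ht => ?_)]
  · simp
  · have h0 : (0 : ℝ) < t := zero_lt_one.trans_le ht
    rw [hset t h0]
    have : {x | ENNReal.ofReal t < f x} = ∅ := by
      ext x
      simp only [Set.mem_ofPred_eq, Set.mem_empty_iff_false, iff_false, not_lt]
      exact (hf1 x).trans (by simpa using ht)
    simp [this]

/-- For functions with supremum `1`, the superlevel sets obey the Brunn–Minkowski inequality. -/
theorem ofReal_mul_lintegral_add_le {f g h : ℝ → ℝ≥0∞} {a b : ℝ} (ha : 0 < a) (hb : 0 < b)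
    (hab : a + b = 1) (hf : Measurable f) (hg : Measurable g) (hh : Measurable h)
    (hf1 : ⨆ x, f x = 1) (hg1 : ⨆ x, g x = 1)
    (H : ∀ x y, f x ^ a * g y ^ b ≤ h (a * x + b * y)) :
    ENNReal.ofReal a * (∫⁻ x, f x) + ENNReal.ofReal b * (∫⁻ x, g x) ≤ ∫⁻ x, h x := by
  have hmono {k : ℝ → ℝ≥0∞} : Measurable fun t : ℝ => volume {x | ENNReal.ofReal t < k x} :=
    Antitone.measurable fun s t hst =>
      measure_mono fun x hx => lt_of_le_of_lt (ENNReal.ofReal_le_ofReal hst) hx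
  have h3 : ∫⁻ x, min (h x) 1 ≤ ∫⁻ x, h x := lintegral_mono fun x => min_le_left _ _
  refine le_trans ?_ h3
  rw [lintegral_eq_setLIntegral_Ioo_volume hf (fun x => hf1 ▸ le_iSup f x),
    lintegral_eq_setLIntegral_Ioo_volume hg (fun x => hg1 ▸ le_iSup g x),
    lintegral_eq_setLIntegral_Ioo_volume (hh.min measurable_const) (fun x => min_le_right _ _),
    ← lintegral_const_mul _ hmono, ← lintegral_const_mul _ hmono,
    ← lintegral_add_left (hmono.const_mul _)]
  refine setLIntegral_mono_ae' measurableSet_Ioo (Filter.Eventually.of_forall fun t ht => ?_)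
  have ht1 : ENNReal.ofReal t < 1 := by simpa using ht.2
  have ht0 : ENNReal.ofReal t ≠ 0 := by simpa using ht.1
  obtain ⟨x₀, hx₀⟩ := lt_iSup_iff.1 (hf1 ▸ ht1)
  obtain ⟨y₀, hy₀⟩ := lt_iSup_iff.1 (hg1 ▸ ht1)
  refine ofReal_mul_volume_add_le ha hb (measurableSet_lt measurable_const hf)
    (measurableSet_lt measurable_const hg) ⟨x₀, hx₀⟩ ⟨y₀, hy₀⟩ fun x hx y hy => lt_min ?_ ht1
  refine lt_of_lt_of_le ?_ (H x y)
  calc ENNReal.ofReal t = ENNReal.ofReal t ^ a * ENNReal.ofReal t ^ b := by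
        rw [← ENNReal.rpow_add _ _ ht0 ENNReal.ofReal_ne_top, hab, ENNReal.rpow_one]
    _ < f x ^ a * g y ^ b :=
        ENNReal.mul_lt_mul (ENNReal.rpow_lt_rpow hx ha) (ENNReal.rpow_lt_rpow hy hb)

/-- The Prékopa–Leindler inequality on the line for bounded functions: after division by the
suprema it follows from the additive form and the inequality of the means. -/
theorem prekopa_leindler_of_iSup_ne_top {f g h : ℝ → ℝ≥0∞} {a b : ℝ} (ha : 0 < a) (hb : 0 < b)
    (hab : a + b = 1) (hf : Measurable f) (hg : Measurable g) (hh : Measurable h)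
    (hf1 : ⨆ x, f x ≠ ⊤) (hg1 : ⨆ x, g x ≠ ⊤)
    (H : ∀ x y, f x ^ a * g y ^ b ≤ h (a * x + b * y)) :
    (∫⁻ x, f x) ^ a * (∫⁻ x, g x) ^ b ≤ ∫⁻ x, h x := by
  set M := ⨆ x, f x with hM
  set N := ⨆ x, g x with hN
  rcases eq_or_ne M 0 with hM0 | hM0
  · have : ∀ x, f x = 0 := ENNReal.iSup_eq_zero.1 hM0
    simp [this, ENNReal.zero_rpow_of_pos ha]
  rcases eq_or_ne N 0 with hN0 | hN0
  · have : ∀ x, g x = 0 := ENNReal.iSup_eq_zero.1 hN0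
    simp [this, ENNReal.zero_rpow_of_pos hb]
  have hP0 : M ^ a * N ^ b ≠ 0 := by
    simp [hM0, hN0, ha.not_gt, hb.not_gt]
  have hPt : M ^ a * N ^ b ≠ ⊤ := ENNReal.mul_ne_top
    (ENNReal.rpow_ne_top_of_nonneg ha.le hf1) (ENNReal.rpow_ne_top_of_nonneg hb.le hg1)
  have hscale (x y : ℝ≥0∞) : (x * M⁻¹) ^ a * (y * N⁻¹) ^ b =
      x ^ a * y ^ b * (M ^ a * N ^ b)⁻¹ := by
    rw [ENNReal.mul_rpow_of_nonneg _ _ ha.le, ENNReal.mul_rpow_of_nonneg _ _ hb.le,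
      ENNReal.inv_rpow, ENNReal.inv_rpow, ENNReal.mul_inv]
    · ring
    · right; exact ENNReal.rpow_ne_top_of_nonneg hb.le hg1
    · left; exact ENNReal.rpow_ne_top_of_nonneg ha.le hf1
  have h1 := ofReal_mul_lintegral_add_le (f := fun x => f x * M⁻¹) (g := fun x => g x * N⁻¹)
    (h := fun x => h x * (M ^ a * N ^ b)⁻¹) ha hb hab (hf.mul_const _) (hg.mul_const _)
    (hh.mul_const _) (by rw [← ENNReal.iSup_mul, ← hM, ENNReal.mul_inv_cancel hM0 hf1])
    (by rw [← ENNReal.iSup_mul, ← hN, ENNReal.mul_inv_cancel hN0 hg1])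
    (fun x y => by rw [hscale]; gcongr; exact H x y)
  have h2 := (ENNReal.rpow_mul_rpow_le_add ha hb hab _ _).trans h1
  rw [lintegral_mul_const _ hf, lintegral_mul_const _ hg, lintegral_mul_const _ hh, hscale] at h2
  exact (ENNReal.mul_le_mul_iff_left (ENNReal.inv_ne_zero.2 hPt)
    (ENNReal.inv_ne_top.2 hP0)).1 h2

theorem ENNReal.iSup_rpow {ι : Sort*} (u : ι → ℝ≥0∞) {a : ℝ} (ha : 0 < a) :
    (⨆ i, u i) ^ a = ⨆ i, u i ^ a :=
  (ENNReal.orderIsoRpow a ha).map_iSup u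

theorem lintegral_eq_iSup_min {f : ℝ → ℝ≥0∞} (hf : Measurable f) :
    ∫⁻ x, f x = ⨆ n : ℕ, ∫⁻ x, min (f x) n := by
  rw [← lintegral_iSup (fun n => hf.min measurable_const)]
  · congr 1
    funext x
    rw [← inf_iSup_eq, ENNReal.iSup_natCast, inf_top_eq]
  · intro m n hmn x
    exact min_le_min_left _ (by exact_mod_cast hmn)

/-- The Prékopa–Leindler inequality on the line. -/
theorem prekopa_leindler_real {f g h : ℝ → ℝ≥0∞} {a b : ℝ} (ha : 0 < a) (hb : 0 < b)
    (hab : a + b = 1) (hf : Measurable f) (hg : Measurable g) (hh : Measurable h)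
    (H : ∀ x y, f x ^ a * g y ^ b ≤ h (a * x + b * y)) :
    (∫⁻ x, f x) ^ a * (∫⁻ x, g x) ^ b ≤ ∫⁻ x, h x := by
  rw [lintegral_eq_iSup_min hf, lintegral_eq_iSup_min hg, ENNReal.iSup_rpow _ ha,
    ENNReal.iSup_rpow _ hb, ENNReal.iSup_mul]
  refine iSup_le fun m => ?_
  rw [ENNReal.mul_iSup]
  refine iSup_le fun n => ?_
  refine prekopa_leindler_of_iSup_ne_top ha hb hab (hf.min measurable_const)
    (hg.min measurable_const) hh
    (ne_top_of_le_ne_top (ENNReal.natCast_ne_top m) (iSup_le fun x => min_le_right _ _))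
    (ne_top_of_le_ne_top (ENNReal.natCast_ne_top n) (iSup_le fun x => min_le_right _ _))
    fun x y => le_trans ?_ (H x y)
  gcongr <;> exact min_le_left _ _

/-- The Prékopa–Leindler inequality in the plane, by applying the inequality on the line to the
sections and then to the marginals. -/
theorem prekopa_leindler_prod {f g h : ℝ × ℝ → ℝ≥0∞} {a b : ℝ} (ha : 0 < a) (hb : 0 < b)
    (hab : a + b = 1) (hf : Measurable f) (hg : Measurable g) (hh : Measurable h)
    (H : ∀ x y, f x ^ a * g y ^ b ≤ h (a • x + b • y)) :
    (∫⁻ x, f x) ^ a * (∫⁻ x, g x) ^ b ≤ ∫⁻ x, h x := by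
  rw [Measure.volume_eq_prod, lintegral_prod _ hf.aemeasurable, lintegral_prod _ hg.aemeasurable,
    lintegral_prod _ hh.aemeasurable]
  refine prekopa_leindler_real ha hb hab hf.lintegral_prod_right' hg.lintegral_prod_right'
    hh.lintegral_prod_right' fun x y => ?_
  exact prekopa_leindler_real ha hb hab (hf.comp measurable_prodMk_left)
    (hg.comp measurable_prodMk_left) (hh.comp measurable_prodMk_left)
    fun s t => H (x, s) (y, t)

/-! ### Coordinates in the plane -/

/-- The identification of `ℝ × ℝ` with the Euclidean plane. -/
noncomputable def prodToPlane : (ℝ × ℝ) ≃L[ℝ] EuclideanSpace ℝ (Fin 2) :=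
  (ContinuousLinearEquiv.finTwoArrow ℝ ℝ).symm.trans
    (PiLp.continuousLinearEquiv 2 ℝ (fun _ : Fin 2 => ℝ)).symm

@[simp] theorem prodToPlane_apply_zero (p : ℝ × ℝ) : prodToPlane p 0 = p.1 := rfl

@[simp] theorem prodToPlane_apply_one (p : ℝ × ℝ) : prodToPlane p 1 = p.2 := rfl

theorem measurePreserving_prodToPlane : MeasurePreserving prodToPlane :=
  (PiLp.volume_preserving_toLp (Fin 2)).comp (volume_preserving_finTwoArrow ℝ).symm

theorem lintegral_comp_prodToPlane (f : EuclideanSpace ℝ (Fin 2) → ℝ≥0∞) :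
    ∫⁻ p, f (prodToPlane p) = ∫⁻ z, f z :=
  measurePreserving_prodToPlane.lintegral_comp_emb
    prodToPlane.toHomeomorph.measurableEmbedding f

theorem norm_prodToPlane_sq (p : ℝ × ℝ) : ‖prodToPlane p‖ ^ 2 = p.1 ^ 2 + p.2 ^ 2 := by
  rw [EuclideanSpace.norm_sq_eq]
  simp

theorem prekopa_leindler_plane {f g h : EuclideanSpace ℝ (Fin 2) → ℝ≥0∞} {a b : ℝ} (ha : 0 < a)
    (hb : 0 < b) (hab : a + b = 1) (hf : Measurable f) (hg : Measurable g) (hh : Measurable h)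
    (H : ∀ x y, f x ^ a * g y ^ b ≤ h (a • x + b • y)) :
    (∫⁻ x, f x) ^ a * (∫⁻ x, g x) ^ b ≤ ∫⁻ x, h x := by
  simp only [← lintegral_comp_prodToPlane]
  have hm := prodToPlane.continuous.measurable
  refine prekopa_leindler_prod ha hb hab (hf.comp hm) (hg.comp hm) (hh.comp hm) fun x y => ?_
  simpa using H (prodToPlane x) (prodToPlane y)

/-! ### A weighted Hardy inequality on half-lines -/

theorem ENNReal.add_sq_le_two_mul (x y : ℝ≥0∞) : (x + y) ^ 2 ≤ 2 * x ^ 2 + 2 * y ^ 2 := by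
  rcases eq_or_ne x ⊤ with rfl | hx
  · simp
  rcases eq_or_ne y ⊤ with rfl | hy
  · simp
  lift x to ℝ≥0 using hx
  lift y to ℝ≥0 using hy
  have := add_sq_le (a := x) (b := y)
  rw [mul_add] at this
  exact_mod_cast this

theorem enorm_sq_le_two_mul (x y : ℂ) :
    ‖x‖ₑ ^ 2 ≤ 2 * ‖y‖ₑ ^ 2 + 2 * ‖x - y‖ₑ ^ 2 := by
  refine le_trans ?_ (ENNReal.add_sq_le_two_mul _ _)
  gcongr
  simpa using enorm_add_le y (x - y)

theorem sq_lintegral_mul_le {α : Type*} [MeasurableSpace α] (μ : Measure α) {f g : α → ℝ≥0∞}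
    (hf : Measurable f) (hg : Measurable g) :
    (∫⁻ x, f x * g x ∂μ) ^ 2 ≤ (∫⁻ x, f x ^ 2 ∂μ) * ∫⁻ x, g x ^ 2 ∂μ := by
  have h := ENNReal.lintegral_mul_le_Lp_mul_Lq μ Real.HolderConjugate.two_two hf.aemeasurable
    hg.aemeasurable
  have hs (x : ℝ≥0∞) : (x ^ (1 / 2 : ℝ)) ^ 2 = x := by
    rw [← ENNReal.rpow_natCast, ← ENNReal.rpow_mul]
    norm_num
  simp only [ENNReal.rpow_two, Pi.mul_apply] at h
  calc _ ≤ _ := pow_le_pow_left' h 2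
    _ = _ := by rw [mul_pow, hs, hs]

/-- The fundamental theorem of calculus and the Cauchy–Schwarz inequality with the weight
`exp (β t)`. -/
theorem sq_enorm_sub_le {v : ℝ → ℂ} (hv : ContDiff ℝ 1 v) (β : ℝ) {r s : ℝ} (hrs : r ≤ s) :
    ‖v s - v r‖ₑ ^ 2 ≤
      (∫⁻ t in Set.Icc r s, ‖deriv v t‖ₑ ^ 2 * ENNReal.ofReal (Real.exp (-(β * t)))) *
        ∫⁻ t in Set.Icc r s, ENNReal.ofReal (Real.exp (β * t)) := by
  have hm : Measurable fun t => ‖deriv v t‖ₑ := (hv.continuous_deriv le_rfl).enorm.measurable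
  have h := enorm_sub_le_lintegral_deriv_of_contDiffOn_Icc hv.contDiffOn hrs
  have h2 := sq_lintegral_mul_le (volume.restrict (Set.Icc r s))
    (f := fun t => ‖deriv v t‖ₑ * ENNReal.ofReal (Real.exp (-(β * t) / 2)))
    (g := fun t => ENNReal.ofReal (Real.exp (β * t / 2))) (by fun_prop) (by fun_prop)
  have e1 (t : ℝ) : ‖deriv v t‖ₑ * ENNReal.ofReal (Real.exp (-(β * t) / 2)) *
      ENNReal.ofReal (Real.exp (β * t / 2)) = ‖deriv v t‖ₑ := by
    rw [mul_assoc, ← ENNReal.ofReal_mul (Real.exp_pos _).le, ← Real.exp_add]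
    ring_nf
    simp
  have e2 (x : ℝ) : ENNReal.ofReal (Real.exp (x / 2)) ^ 2 = ENNReal.ofReal (Real.exp x) := by
    rw [← ENNReal.ofReal_pow (Real.exp_pos _).le, ← Real.exp_nat_mul]
    congr 2
    push_cast; ring
  simp only [e1, e2, mul_pow] at h2
  exact (pow_le_pow_left' h 2).trans h2

theorem setLIntegral_Icc_exp_le {β : ℝ} (hβ : 0 < β) (r s : ℝ) :
    ∫⁻ t in Set.Icc r s, ENNReal.ofReal (Real.exp (β * t)) ≤
      ENNReal.ofReal (Real.exp (β * s) / β) := by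
  rw [← integral_exp_mul_Iic hβ, ofReal_integral_eq_lintegral_ofReal
    (integrableOn_exp_mul_Iic hβ _) (Filter.Eventually.of_forall fun x => (Real.exp_pos _).le)]
  exact lintegral_mono_set fun x hx => hx.2

theorem setLIntegral_Ici_exp_neg {β : ℝ} (hβ : 0 < β) (r : ℝ) :
    ∫⁻ t in Set.Ici r, ENNReal.ofReal (Real.exp (-β * t)) =
      ENNReal.ofReal (Real.exp (-β * r) / β) := by
  have h := integral_exp_mul_Ioi (neg_lt_zero.2 hβ) r
  rw [neg_div_neg_eq] at h
  rw [← h, ofReal_integral_eq_lintegral_ofReal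
    (integrableOn_exp_mul_Ioi (neg_lt_zero.2 hβ) _)
    (Filter.Eventually.of_forall fun x => (Real.exp_pos _).le),
    Measure.restrict_congr_set Ioi_ae_eq_Ici]

/-- Tonelli's theorem on the region `r ≤ t ≤ s`. -/
theorem setLIntegral_Ici_mul_setLIntegral_Icc {G H : ℝ → ℝ≥0∞} (hG : Measurable G)
    (hH : Measurable H) (r : ℝ) :
    ∫⁻ s in Set.Ici r, H s * ∫⁻ t in Set.Icc r s, G t =
      ∫⁻ t in Set.Ici r, G t * ∫⁻ s in Set.Ici t, H s := by
  let T : Set (ℝ × ℝ) := {p | r ≤ p.2 ∧ p.2 ≤ p.1}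
  have hT : MeasurableSet T := (measurableSet_le measurable_const measurable_snd).inter
    (measurableSet_le measurable_snd measurable_fst)
  let F : ℝ → ℝ → ℝ≥0∞ := fun s t => T.indicator (fun p => H p.1 * G p.2) (s, t)
  have hF : Measurable (Function.uncurry F) := by
    have h1 : Measurable fun p : ℝ × ℝ => H p.1 * G p.2 := by fun_prop
    exact h1.indicator hT
  have hs := lintegral_lintegral_swap (μ := volume) (ν := volume) hF.aemeasurable
  have e1 (s : ℝ) : ∫⁻ t, F s t =
      (Set.Ici r).indicator (fun s => H s * ∫⁻ t in Set.Icc r s, G t) s := by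
    by_cases h : r ≤ s
    · rw [Set.indicator_of_mem (show s ∈ Set.Ici r from h), ← lintegral_const_mul _ hG,
        ← lintegral_indicator measurableSet_Icc]
      rfl
    · rw [Set.indicator_of_notMem (show s ∉ Set.Ici r from h)]
      have : ∀ t, F s t = 0 := fun t => Set.indicator_of_notMem (fun ht => h (ht.1.trans ht.2)) _
      simp [this]
  have e2 (t : ℝ) : ∫⁻ s, F s t =
      (Set.Ici r).indicator (fun t => G t * ∫⁻ s in Set.Ici t, H s) t := by
    by_cases h : r ≤ t
    · rw [Set.indicator_of_mem (show t ∈ Set.Ici r from h), ← lintegral_const_mul _ hH,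
        ← lintegral_indicator measurableSet_Ici]
      congr 1
      funext s
      by_cases hst : t ≤ s
      · rw [Set.indicator_of_mem (show s ∈ Set.Ici t from hst), mul_comm]
        exact Set.indicator_of_mem (show (s, t) ∈ T from ⟨h, hst⟩) _
      · rw [Set.indicator_of_notMem (show s ∉ Set.Ici t from hst)]
        exact Set.indicator_of_notMem (fun ht => hst ht.2) _
    · rw [Set.indicator_of_notMem (show t ∉ Set.Ici r from h)]
      have : ∀ s, F s t = 0 := fun s => Set.indicator_of_notMem (fun ht => h ht.1) _
      simp [this]
  rw [← lintegral_indicator measurableSet_Ici, ← lintegral_indicator measurableSet_Ici]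
  simpa only [e1, e2] using hs

theorem setLIntegral_mul_exp_le {ρ : ℝ → ℝ≥0∞} {α β R : ℝ} (hβ : β < α)
    (hρ : ∀ r s, R ≤ r → r ≤ s → ρ s ≤ ρ r * ENNReal.ofReal (Real.exp (-α * (s - r))))
    {t : ℝ} (ht : R ≤ t) :
    ∫⁻ s in Set.Ici t, ρ s * ENNReal.ofReal (Real.exp (β * s)) ≤
      ρ t * ENNReal.ofReal (Real.exp (β * t) / (α - β)) := by
  have h1 : ∀ s ∈ Set.Ici t, ρ s * ENNReal.ofReal (Real.exp (β * s)) ≤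
      ρ t * ENNReal.ofReal (Real.exp (α * t)) * ENNReal.ofReal (Real.exp (-(α - β) * s)) := by
    intro s hs
    refine (mul_le_mul_left (hρ t s ht hs) _).trans_eq ?_
    rw [mul_assoc, mul_assoc, ← ENNReal.ofReal_mul (Real.exp_pos _).le,
      ← ENNReal.ofReal_mul (Real.exp_pos _).le, ← Real.exp_add, ← Real.exp_add]
    ring_nf
  refine (setLIntegral_mono' measurableSet_Ici h1).trans_eq ?_
  rw [lintegral_const_mul _ (by fun_prop), setLIntegral_Ici_exp_neg (sub_pos.2 hβ), mul_assoc,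
    ← ENNReal.ofReal_mul (Real.exp_pos _).le, ← mul_div_assoc, ← Real.exp_add]
  ring_nf

theorem setLIntegral_sq_enorm_sub_mul_le {v : ℝ → ℂ} (hv : ContDiff ℝ 1 v) {ρ : ℝ → ℝ≥0∞}
    (hρm : Measurable ρ) {α R : ℝ} (hα : 0 < α)
    (hρ : ∀ r s, R ≤ r → r ≤ s → ρ s ≤ ρ r * ENNReal.ofReal (Real.exp (-α * (s - r))))
    {r : ℝ} (hr : R ≤ r) :
    ∫⁻ s in Set.Ici r, ‖v s - v r‖ₑ ^ 2 * ρ s ≤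
      ENNReal.ofReal (4 / α ^ 2) * ∫⁻ t in Set.Ici r, ‖deriv v t‖ₑ ^ 2 * ρ t := by
  -- The Cauchy–Schwarz weight grows at half the rate at which `ρ` decays.
  set β := α / 2 with hβ
  have hβ0 : 0 < β := by positivity
  have hm : Measurable fun t => ‖deriv v t‖ₑ := (hv.continuous_deriv le_rfl).enorm.measurable
  have hG : Measurable fun t => ‖deriv v t‖ₑ ^ 2 * ENNReal.ofReal (Real.exp (-(β * t))) := by
    fun_prop
  have hH : Measurable fun s => ENNReal.ofReal β⁻¹ * (ρ s * ENNReal.ofReal (Real.exp (β * s))) := by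
    fun_prop
  calc ∫⁻ s in Set.Ici r, ‖v s - v r‖ₑ ^ 2 * ρ s
      ≤ ∫⁻ s in Set.Ici r, (ENNReal.ofReal β⁻¹ * (ρ s * ENNReal.ofReal (Real.exp (β * s)))) *
          ∫⁻ t in Set.Icc r s, ‖deriv v t‖ₑ ^ 2 * ENNReal.ofReal (Real.exp (-(β * t))) := by
        refine setLIntegral_mono' measurableSet_Ici fun s hs => ?_
        have h1 := (sq_enorm_sub_le hv β hs).trans
          (mul_le_mul_right (setLIntegral_Icc_exp_le hβ0 r s) _)
        refine (mul_le_mul_left h1 _).trans_eq ?_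
        rw [div_eq_mul_inv, ENNReal.ofReal_mul (Real.exp_pos _).le]
        ring
    _ = ∫⁻ t in Set.Ici r, (‖deriv v t‖ₑ ^ 2 * ENNReal.ofReal (Real.exp (-(β * t)))) *
          ∫⁻ s in Set.Ici t, ENNReal.ofReal β⁻¹ * (ρ s * ENNReal.ofReal (Real.exp (β * s))) :=
        setLIntegral_Ici_mul_setLIntegral_Icc hG hH r
    _ ≤ ∫⁻ t in Set.Ici r, ENNReal.ofReal (4 / α ^ 2) * (‖deriv v t‖ₑ ^ 2 * ρ t) := by
        refine setLIntegral_mono' measurableSet_Ici fun t ht => ?_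
        rw [lintegral_const_mul _ (by fun_prop)]
        have h2 := setLIntegral_mul_exp_le (β := β) (by linarith) hρ (hr.trans ht)
        refine (mul_le_mul_right (mul_le_mul_right h2 _) _).trans_eq ?_
        have e : ENNReal.ofReal (Real.exp (-(β * t))) *
            (ENNReal.ofReal β⁻¹ * ENNReal.ofReal (Real.exp (β * t) / (α - β))) =
            ENNReal.ofReal (4 / α ^ 2) := by
          rw [← ENNReal.ofReal_mul (by positivity), ← ENNReal.ofReal_mul (Real.exp_pos _).le,
            Real.exp_neg]
          congr 1
          have h3 := Real.exp_pos (β * t)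
          have h4 : α - β = β := by rw [hβ]; ring
          rw [h4, show α = 2 * β by rw [hβ]; ring]
          field_simp
          norm_num
        rw [← e]
        ring
    _ = _ := lintegral_const_mul _ (by fun_prop)

/-- A Hardy inequality on a half-line, for a weight `ρ` that decays exponentially beyond `R`. -/
theorem setLIntegral_Ici_hardy {v : ℝ → ℂ} (hv : ContDiff ℝ 1 v) {ρ : ℝ → ℝ≥0∞}
    (hρm : Measurable ρ) {α R L : ℝ} (hα : 0 < α) (hL : 0 < L)
    (hρ : ∀ r s, R ≤ r → r ≤ s → ρ s ≤ ρ r * ENNReal.ofReal (Real.exp (-α * (s - r)))) :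
    ∫⁻ s in Set.Ici (R + L), ‖v s‖ₑ ^ 2 * ρ s ≤
      ENNReal.ofReal (2 / (α * L)) * (∫⁻ s in Set.Icc R (R + L), ‖v s‖ₑ ^ 2 * ρ s) +
        ENNReal.ofReal (8 / α ^ 2) * ∫⁻ s in Set.Ici R, ‖deriv v s‖ₑ ^ 2 * ρ s := by
  have hm : Measurable fun t => ‖v t‖ₑ := hv.continuous.enorm.measurable
  have hm' : Measurable fun t => ‖deriv v t‖ₑ := (hv.continuous_deriv le_rfl).enorm.measurable
  set A := ∫⁻ s in Set.Ici (R + L), ‖v s‖ₑ ^ 2 * ρ s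
  set D := ∫⁻ s in Set.Ici R, ‖deriv v s‖ₑ ^ 2 * ρ s
  have key : ∀ r ∈ Set.Icc R (R + L),
      A ≤ ENNReal.ofReal (2 / α) * (‖v r‖ₑ ^ 2 * ρ r) + ENNReal.ofReal (8 / α ^ 2) * D := by
    intro r hr
    calc A ≤ ∫⁻ s in Set.Ici r, ‖v s‖ₑ ^ 2 * ρ s :=
          lintegral_mono_set (Set.Ici_subset_Ici.2 hr.2)
      _ ≤ ∫⁻ s in Set.Ici r, (2 * ‖v r‖ₑ ^ 2 * ρ s + 2 * (‖v s - v r‖ₑ ^ 2 * ρ s)) := by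
          refine lintegral_mono fun s => ?_
          refine (mul_le_mul_left (enorm_sq_le_two_mul (v s) (v r)) _).trans_eq ?_
          ring
      _ = 2 * ‖v r‖ₑ ^ 2 * (∫⁻ s in Set.Ici r, ρ s) +
            2 * ∫⁻ s in Set.Ici r, ‖v s - v r‖ₑ ^ 2 * ρ s := by
          have hm2 : Measurable fun s => ‖v s - v r‖ₑ :=
            (hv.continuous.sub continuous_const).enorm.measurable
          rw [lintegral_add_left (by fun_prop), lintegral_const_mul _ hρm,
            lintegral_const_mul _ (by fun_prop)]
      _ ≤ 2 * ‖v r‖ₑ ^ 2 * (ρ r * ENNReal.ofReal (1 / α)) +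
            2 * (ENNReal.ofReal (4 / α ^ 2) * D) := by
          have h1 := setLIntegral_mul_exp_le (β := 0) hα hρ hr.1
          simp only [zero_mul, Real.exp_zero, ENNReal.ofReal_one, mul_one, sub_zero] at h1
          have h2 := setLIntegral_sq_enorm_sub_mul_le hv hρm hα hρ hr.1
          have h3 : ∫⁻ t in Set.Ici r, ‖deriv v t‖ₑ ^ 2 * ρ t ≤ D :=
            lintegral_mono_set (Set.Ici_subset_Ici.2 hr.1)
          gcongr
          exact h2.trans (mul_le_mul_right h3 _)
      _ = _ := by
          rw [show (2 : ℝ) / α = 2 * (1 / α) by ring, show 8 / α ^ 2 = 2 * (4 / α ^ 2) by ring,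
            ENNReal.ofReal_mul zero_le_two, ENNReal.ofReal_mul zero_le_two, ENNReal.ofReal_ofNat]
          ring
  have hint := setLIntegral_mono' measurableSet_Icc key (μ := volume)
  rw [lintegral_add_left (by fun_prop), lintegral_const_mul _ (by fun_prop), setLIntegral_const,
    setLIntegral_const, Real.volume_Icc, add_sub_cancel_left] at hint
  have hLi : ENNReal.ofReal L * ENNReal.ofReal L⁻¹ = 1 := by
    rw [← ENNReal.ofReal_mul hL.le, mul_inv_cancel₀ hL.ne', ENNReal.ofReal_one]
  calc A = A * ENNReal.ofReal L * ENNReal.ofReal L⁻¹ := by rw [mul_assoc, hLi, mul_one]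
    _ ≤ _ := mul_le_mul_left hint _
    _ = _ := by
      rw [show 2 / (α * L) = 2 / α * L⁻¹ by field_simp,
        ENNReal.ofReal_mul (p := 2 / α) (by positivity), add_mul, mul_assoc (ENNReal.ofReal (8 / α ^ 2) * D), hLi]
      ring

/-! ### Polar coordinates and the reduction to a disc -/

/-- The unit vector with angle `θ`. -/
noncomputable def unitVec (θ : ℝ) : EuclideanSpace ℝ (Fin 2) :=
  prodToPlane (Real.cos θ, Real.sin θ)

theorem norm_unitVec (θ : ℝ) : ‖unitVec θ‖ = 1 := by
  have h := norm_prodToPlane_sq (Real.cos θ, Real.sin θ)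
  simp only [Real.cos_sq_add_sin_sq] at h
  exact (pow_eq_one_iff_of_nonneg (norm_nonneg _) two_ne_zero).1 h

theorem continuous_smul_unitVec : Continuous fun p : ℝ × ℝ => p.1 • unitVec p.2 := by
  unfold unitVec
  have := prodToPlane.continuous
  fun_prop

theorem lintegral_plane_eq_polar {f : EuclideanSpace ℝ (Fin 2) → ℝ≥0∞} (hf : Measurable f) :
    ∫⁻ z, f z = ∫⁻ θ in Set.Ioo (-Real.pi) Real.pi, ∫⁻ r in Set.Ioi (0 : ℝ),
      ENNReal.ofReal r * f (r • unitVec θ) := by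
  have hm : Measurable fun p : ℝ × ℝ => ENNReal.ofReal p.1 * f (p.1 • unitVec p.2) :=
    measurable_fst.ennreal_ofReal.mul (hf.comp continuous_smul_unitVec.measurable)
  rw [← lintegral_comp_prodToPlane, ← lintegral_comp_polarCoord_symm, polarCoord_target,
    Measure.volume_eq_prod, ← Measure.prod_restrict]
  have he (p : ℝ × ℝ) : prodToPlane (polarCoord.symm p) = p.1 • unitVec p.2 := by
    rw [unitVec, ← map_smul]
    rfl
  simp only [he, smul_eq_mul]
  rw [lintegral_prod_symm _ hm.aemeasurable]

/-- A directional derivative is bounded by the norm of the gradient. -/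
theorem enorm_fderiv_sq_le (u : EuclideanSpace ℝ (Fin 2) → ℂ) (z : EuclideanSpace ℝ (Fin 2))
    (θ : ℝ) : ‖fderiv ℝ u z (unitVec θ)‖ₑ ^ 2 ≤ ∑ i, ‖partialDeriv i u z‖ₑ ^ 2 := by
  have hv : unitVec θ = Real.cos θ • EuclideanSpace.single 0 1 +
      Real.sin θ • EuclideanSpace.single 1 1 := by
    ext i
    fin_cases i <;> simp [unitVec]
  have hr : ‖fderiv ℝ u z (unitVec θ)‖ ^ 2 ≤
      ‖partialDeriv 0 u z‖ ^ 2 + ‖partialDeriv 1 u z‖ ^ 2 := by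
    rw [hv, map_add, map_smul, map_smul]
    change ‖Real.cos θ • partialDeriv 0 u z + Real.sin θ • partialDeriv 1 u z‖ ^ 2 ≤ _
    set a := partialDeriv 0 u z
    set b := partialDeriv 1 u z
    have h1 : ‖Real.cos θ • a + Real.sin θ • b‖ ≤ |Real.cos θ| * ‖a‖ + |Real.sin θ| * ‖b‖ := by
      refine (norm_add_le _ _).trans_eq ?_
      rw [norm_smul, norm_smul, Real.norm_eq_abs, Real.norm_eq_abs]
    have h2 : |Real.cos θ| ^ 2 + |Real.sin θ| ^ 2 = 1 := by
      rw [sq_abs, sq_abs, Real.cos_sq_add_sin_sq]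
    calc _ ≤ (|Real.cos θ| * ‖a‖ + |Real.sin θ| * ‖b‖) ^ 2 := by gcongr
      _ ≤ (|Real.cos θ| ^ 2 + |Real.sin θ| ^ 2) * (‖a‖ ^ 2 + ‖b‖ ^ 2) := by
        nlinarith [sq_nonneg (|Real.cos θ| * ‖b‖ - |Real.sin θ| * ‖a‖)]
      _ = _ := by rw [h2, one_mul]
  rw [Fin.sum_univ_two]
  simp only [← ofReal_norm, ← ENNReal.ofReal_pow (norm_nonneg _)]
  rw [← ENNReal.ofReal_add (by positivity) (by positivity)]
  exact ENNReal.ofReal_le_ofReal hr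

theorem hasDerivAt_comp_add_smul {u : EuclideanSpace ℝ (Fin 2) → ℂ} (hu : ContDiff ℝ 1 u)
    (p d : EuclideanSpace ℝ (Fin 2)) (t : ℝ) :
    HasDerivAt (fun t : ℝ => u (p + t • d)) (fderiv ℝ u (p + t • d) d) t := by
  have h1 : HasDerivAt (fun t : ℝ => p + t • d) d t := by
    simpa using ((hasDerivAt_id t).smul_const d).const_add p
  exact ((hu.differentiable one_ne_zero) _).hasFDerivAt.comp_hasDerivAt t h1

theorem measurable_enorm_partialDeriv {u : EuclideanSpace ℝ (Fin 2) → ℂ} (hu : ContDiff ℝ 1 u)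
    (i : Fin 2) : Measurable fun z => ‖partialDeriv i u z‖ₑ :=
  (((hu.continuous_fderiv one_ne_zero).clm_apply continuous_const).enorm).measurable

/-- For a weight that decays exponentially along the rays beyond the disc of radius `R`, Hardy's
inequality along the rays reduces the Poincaré inequality to the disc of radius `2R`. -/
theorem lintegral_sq_enorm_sub_mul_le {w : EuclideanSpace ℝ (Fin 2) → ℝ} (hw : Continuous w)
    (hw0 : ∀ z, 0 ≤ w z) {R : ℝ} (hR : 0 < R)
    (hdecay : ∀ θ r s, R ≤ r → r ≤ s →
      w (s • unitVec θ) ≤ w (r • unitVec θ) * Real.exp (-(2 / R) * (s - r)))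
    {u : EuclideanSpace ℝ (Fin 2) → ℂ} (hu : ContDiff ℝ 1 u) (c : ℂ) :
    sqNormL2 w (fun z => u z - c) ≤
      3 * (∫⁻ z in Metric.closedBall 0 (2 * R), ‖u z - c‖ₑ ^ 2 * ENNReal.ofReal (w z)) +
        ENNReal.ofReal (8 * R ^ 2) * sqNormGradL2 w u := by
  have hmu : Measurable fun z => ‖u z - c‖ₑ := (hu.continuous.sub continuous_const).enorm.measurable
  have hmw : Measurable fun z => ENNReal.ofReal (w z) := hw.measurable.ennreal_ofReal
  have hmd := measurable_enorm_partialDeriv hu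
  have hmg : Measurable fun z => (∑ i, ‖partialDeriv i u z‖ₑ ^ 2) * ENNReal.ofReal (w z) := by
    fun_prop
  have hmi : Measurable ((Metric.closedBall 0 (2 * R)).indicator
      fun z => ‖u z - c‖ₑ ^ 2 * ENNReal.ofReal (w z)) :=
    Measurable.indicator (by fun_prop) Metric.isClosed_closedBall.measurableSet
  have hms := Measurable.fun_add (hmi.const_mul 3) (hmg.const_mul (ENNReal.ofReal (8 * R ^ 2)))
  have hray (θ : ℝ) : Measurable fun r : ℝ => r • unitVec θ := by fun_prop
  rw [sqNormL2, sqNormGradL2, ← lintegral_indicator Metric.isClosed_closedBall.measurableSet,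
    ← lintegral_const_mul _ hmi, ← lintegral_const_mul _ hmg,
    ← lintegral_add_left (hmi.const_mul _), lintegral_plane_eq_polar (by fun_prop),
    lintegral_plane_eq_polar hms]
  refine lintegral_mono fun θ => ?_
  set ρ : ℝ → ℝ≥0∞ := fun r => ENNReal.ofReal r * ENNReal.ofReal (w (r • unitVec θ)) with hρdef
  set v : ℝ → ℂ := fun r => u (r • unitVec θ) - c with hvdef
  have hρm : Measurable ρ := measurable_id.ennreal_ofReal.mul (hmw.comp (hray θ))
  have hv : ContDiff ℝ 1 v := by fun_prop
  have hv' (r : ℝ) : deriv v r = fderiv ℝ u (r • unitVec θ) (unitVec θ) := by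
    have h := (hasDerivAt_comp_add_smul hu 0 (unitVec θ) r).sub_const c
    simp only [zero_add] at h
    exact h.deriv
  have hρ : ∀ r s, R ≤ r → r ≤ s → ρ s ≤ ρ r * ENNReal.ofReal (Real.exp (-(1 / R) * (s - r))) := by
    intro r s hr hs
    have hr0 : 0 < r := hR.trans_le hr
    simp only [hρdef]
    rw [← ENNReal.ofReal_mul (hr0.le.trans hs), ← ENNReal.ofReal_mul hr0.le,
      ← ENNReal.ofReal_mul (mul_nonneg hr0.le (hw0 _))]
    refine ENNReal.ofReal_le_ofReal ?_
    -- The Jacobian `s / r ≤ exp ((s - r) / R)` costs half of the decay of `w`.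
    have h1 : s ≤ r * Real.exp ((1 / R) * (s - r)) := by
      have h2 : s / r ≤ Real.exp ((1 / R) * (s - r)) := by
        calc s / r = (s - r) / r + 1 := by field_simp; ring
          _ ≤ Real.exp ((s - r) / r) := Real.add_one_le_exp _
          _ ≤ _ := by
            rw [one_div, inv_mul_eq_div]
            gcongr
      rwa [div_le_iff₀' hr0] at h2
    calc s * w (s • unitVec θ) ≤ (r * Real.exp ((1 / R) * (s - r))) *
          (w (r • unitVec θ) * Real.exp (-(2 / R) * (s - r))) :=
        mul_le_mul h1 (hdecay θ r s hr hs) (hw0 _) (by positivity)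
      _ = r * w (r • unitVec θ) *
          (Real.exp ((1 / R) * (s - r)) * Real.exp (-(2 / R) * (s - r))) := by ring
      _ = _ := by rw [← Real.exp_add]; ring_nf
  have hhardy := setLIntegral_Ici_hardy hv hρm (one_div_pos.2 hR) hR hρ
  have hc1 : 2 / (1 / R * R) = 2 := by field_simp
  have hc2 : 8 / (1 / R) ^ 2 = 8 * R ^ 2 := by field_simp
  rw [hc1, hc2, ← two_mul, ENNReal.ofReal_ofNat] at hhardy
  have hmv : Measurable fun r => ‖v r‖ₑ := hv.continuous.enorm.measurable
  calc ∫⁻ r in Set.Ioi (0 : ℝ), ENNReal.ofReal r * (‖u (r • unitVec θ) - c‖ₑ ^ 2 *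
          ENNReal.ofReal (w (r • unitVec θ)))
      = ∫⁻ r in Set.Ioi (0 : ℝ), ‖v r‖ₑ ^ 2 * ρ r := by
        congr 1; funext r; simp only [hvdef, hρdef]; ring
    _ ≤ (∫⁻ r in Set.Ioc 0 (2 * R), ‖v r‖ₑ ^ 2 * ρ r) +
          ∫⁻ r in Set.Ici (2 * R), ‖v r‖ₑ ^ 2 * ρ r := by
        refine le_trans (lintegral_mono_set fun r (hr : 0 < r) => ?_) (lintegral_union_le _ _ _)
        rcases le_total r (2 * R) with h | h
        exacts [Or.inl ⟨hr, h⟩, Or.inr h]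
    _ ≤ (∫⁻ r in Set.Ioc 0 (2 * R), ‖v r‖ₑ ^ 2 * ρ r) +
          (2 * (∫⁻ r in Set.Ioc 0 (2 * R), ‖v r‖ₑ ^ 2 * ρ r) +
          ENNReal.ofReal (8 * R ^ 2) * ∫⁻ r in Set.Ioi 0, ‖deriv v r‖ₑ ^ 2 * ρ r) := by
        gcongr
        refine hhardy.trans ?_
        gcongr
    _ = 3 * (∫⁻ r in Set.Ioc 0 (2 * R), ‖v r‖ₑ ^ 2 * ρ r) +
          ENNReal.ofReal (8 * R ^ 2) * ∫⁻ r in Set.Ioi 0, ‖deriv v r‖ₑ ^ 2 * ρ r := by ring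
    _ ≤ _ := by
        have hmd' : Measurable fun r => ‖deriv v r‖ₑ :=
          (hv.continuous_deriv le_rfl).enorm.measurable
        have hm1 : Measurable ((Set.Iic (2 * R)).indicator fun r => ‖v r‖ₑ ^ 2 * ρ r) :=
          Measurable.indicator (by fun_prop) measurableSet_Iic
        rw [← Set.Ioi_inter_Iic, Set.inter_comm, ← setLIntegral_indicator measurableSet_Iic,
          ← lintegral_const_mul _ hm1, ← lintegral_const_mul _ (by fun_prop),
          ← lintegral_add_left (hm1.const_mul _)]
        refine setLIntegral_mono' measurableSet_Ioi fun r hr => ?_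
        have hr0 : 0 < r := hr
        have hnorm : ‖r • unitVec θ‖ = r := by
          rw [norm_smul, norm_unitVec, mul_one, Real.norm_of_nonneg hr0.le]
        have h1 : (Set.Iic (2 * R)).indicator (fun r => ‖v r‖ₑ ^ 2 * ρ r) r =
            ENNReal.ofReal r * (Metric.closedBall 0 (2 * R)).indicator
              (fun z => ‖u z - c‖ₑ ^ 2 * ENNReal.ofReal (w z)) (r • unitVec θ) := by
          by_cases h : r ≤ 2 * R
          · rw [Set.indicator_of_mem (show r ∈ Set.Iic (2 * R) from h), Set.indicator_of_mem
              (show r • unitVec θ ∈ Metric.closedBall 0 (2 * R) by simpa [hnorm] using h)]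
            simp only [hvdef, hρdef]; ring
          · rw [Set.indicator_of_notMem (show r ∉ Set.Iic (2 * R) from h), Set.indicator_of_notMem
              (show r • unitVec θ ∉ Metric.closedBall 0 (2 * R) by simpa [hnorm] using h), mul_zero]
        rw [h1, hv', mul_add]
        refine add_le_add (le_of_eq (by ring)) ?_
        calc _ ≤ ENNReal.ofReal (8 * R ^ 2) *
              ((∑ i, ‖partialDeriv i u (r • unitVec θ)‖ₑ ^ 2) * ρ r) := by
              gcongr
              exact enorm_fderiv_sq_le u _ θ
          _ = _ := by simp only [hρdef]; ring

/-! ### The Poincaré inequality on a square -/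

theorem sq_enorm_sub_le_of_mem_Icc {v : ℝ → ℂ} (hv : ContDiff ℝ 1 v) {L x y : ℝ}
    (hx : x ∈ Set.Icc (-L) L) (hy : y ∈ Set.Icc (-L) L) :
    ‖v x - v y‖ₑ ^ 2 ≤ ENNReal.ofReal (2 * L) * ∫⁻ t in Set.Icc (-L) L, ‖deriv v t‖ₑ ^ 2 := by
  wlog h : y ≤ x generalizing x y
  · rw [← neg_sub, enorm_neg]
    exact this hy hx (le_of_not_ge h)
  have h1 := sq_enorm_sub_le hv 0 h
  simp only [zero_mul, neg_zero, Real.exp_zero, ENNReal.ofReal_one, mul_one, setLIntegral_const,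
    Real.volume_Icc, one_mul] at h1
  have hsub : Set.Icc y x ⊆ Set.Icc (-L) L := Set.Icc_subset_Icc hy.1 hx.2
  rw [mul_comm] at h1
  refine h1.trans ?_
  gcongr
  linarith [hx.2, hy.1]

/-- The Poincaré inequality on a square for Lebesgue measure, with a double integral in place of
the variance. -/
theorem lintegral_square_sq_enorm_sub_le {u : EuclideanSpace ℝ (Fin 2) → ℂ} (hu : ContDiff ℝ 1 u)
    {L : ℝ} (hL : 0 < L) {μ : Measure ℝ} (hμ : μ = volume.restrict (Set.Icc (-L) L)) :
    ∫⁻ q, ∫⁻ p, ‖u (prodToPlane p) - u (prodToPlane q)‖ₑ ^ 2 ∂(μ.prod μ) ∂(μ.prod μ) ≤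
      ENNReal.ofReal (32 * L ^ 4) *
        ∫⁻ p, ∑ i, ‖partialDeriv i u (prodToPlane p)‖ₑ ^ 2 ∂(μ.prod μ) := by
  have hmass : μ Set.univ = ENNReal.ofReal (2 * L) := by
    rw [hμ, Measure.restrict_apply_univ, Real.volume_Icc]
    congr 1; ring
  have : IsFiniteMeasure μ := ⟨by rw [hmass]; exact ENNReal.ofReal_lt_top⟩
  have hmass2 : (μ.prod μ) Set.univ = ENNReal.ofReal (2 * L) * ENNReal.ofReal (2 * L) := by
    rw [← Set.univ_prod_univ, Measure.prod_prod, hmass]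
  have hmp := prodToPlane.continuous.measurable
  have hmd (i : Fin 2) : Measurable fun p => ‖partialDeriv i u (prodToPlane p)‖ₑ :=
    (measurable_enorm_partialDeriv hu i).comp hmp
  -- The derivatives along the two coordinate lines through a point.
  have hs0 : prodToPlane (1, 0) = EuclideanSpace.single 0 1 := by
    ext i; fin_cases i <;> simp
  have hs1 : prodToPlane (0, 1) = EuclideanSpace.single 1 1 := by
    ext i; fin_cases i <;> simp
  have hline0 (x y : ℝ) : prodToPlane (0, y) + x • prodToPlane (1, 0) = prodToPlane (x, y) := by
    rw [← map_smul, ← map_add]; simp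
  have hline1 (x y : ℝ) : prodToPlane (x, 0) + y • prodToPlane (0, 1) = prodToPlane (x, y) := by
    rw [← map_smul, ← map_add]; simp
  have hd0 (x y : ℝ) : deriv (fun t => u (prodToPlane (t, y))) x =
      partialDeriv 0 u (prodToPlane (x, y)) := by
    have h := hasDerivAt_comp_add_smul hu (prodToPlane (0, y)) (prodToPlane (1, 0)) x
    simp only [hline0] at h
    rw [h.deriv, hs0, partialDeriv]
  have hd1 (x y : ℝ) : deriv (fun t => u (prodToPlane (x, t))) y =
      partialDeriv 1 u (prodToPlane (x, y)) := by
    have h := hasDerivAt_comp_add_smul hu (prodToPlane (x, 0)) (prodToPlane (0, 1)) y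
    simp only [hline1] at h
    rw [h.deriv, hs1, partialDeriv]
  have hpc : ContDiff ℝ 1 prodToPlane := prodToPlane.contDiff
  set A : ℝ → ℝ≥0∞ := fun y => ∫⁻ t, ‖partialDeriv 0 u (prodToPlane (t, y))‖ₑ ^ 2 ∂μ
  set B : ℝ → ℝ≥0∞ := fun x => ∫⁻ t, ‖partialDeriv 1 u (prodToPlane (x, t))‖ₑ ^ 2 ∂μ
  have hAm : Measurable A := ((hmd 0).pow_const 2).lintegral_prod_left'
  have hBm : Measurable B := ((hmd 1).pow_const 2).lintegral_prod_right'
  have hae : ∀ᵐ p ∂(μ.prod μ), p ∈ Set.Icc (-L) L ×ˢ Set.Icc (-L) L := by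
    rw [hμ, Measure.prod_restrict]
    exact ae_restrict_mem (measurableSet_Icc.prod measurableSet_Icc)
  have hpt : ∀ p ∈ Set.Icc (-L) L ×ˢ Set.Icc (-L) L, ∀ q ∈ Set.Icc (-L) L ×ˢ Set.Icc (-L) L,
      ‖u (prodToPlane p) - u (prodToPlane q)‖ₑ ^ 2 ≤
        2 * ENNReal.ofReal (2 * L) * (A p.2 + B q.1) := by
    rintro ⟨x₁, x₂⟩ ⟨hx₁, hx₂⟩ ⟨y₁, y₂⟩ ⟨hy₁, hy₂⟩
    have h0 := sq_enorm_sub_le_of_mem_Icc (v := fun t => u (prodToPlane (t, x₂)))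
      (by fun_prop) hx₁ hy₁
    have h1 := sq_enorm_sub_le_of_mem_Icc (v := fun t => u (prodToPlane (y₁, t)))
      (by fun_prop) hx₂ hy₂
    simp only [hd0, hd1, ← hμ] at h0 h1
    calc _ ≤ (‖u (prodToPlane (x₁, x₂)) - u (prodToPlane (y₁, x₂))‖ₑ +
          ‖u (prodToPlane (y₁, x₂)) - u (prodToPlane (y₁, y₂))‖ₑ) ^ 2 := by
          gcongr
          refine le_trans (le_of_eq ?_) (enorm_add_le _ _)
          rw [sub_add_sub_cancel]
      _ ≤ _ := ENNReal.add_sq_le_two_mul _ _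
      _ ≤ 2 * (ENNReal.ofReal (2 * L) * A x₂) + 2 * (ENNReal.ofReal (2 * L) * B y₁) := by
          gcongr
      _ = _ := by ring
  have hsum : ∫⁻ p, ∑ i, ‖partialDeriv i u (prodToPlane p)‖ₑ ^ 2 ∂(μ.prod μ) =
      ∫⁻ y, A y ∂μ + ∫⁻ x, B x ∂μ := by
    simp only [Fin.sum_univ_two]
    rw [lintegral_add_left ((hmd 0).pow_const 2),
      lintegral_prod_symm _ ((hmd 0).pow_const 2).aemeasurable,
      lintegral_prod _ ((hmd 1).pow_const 2).aemeasurable]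
  have hAp : ∫⁻ p : ℝ × ℝ, A p.2 ∂(μ.prod μ) = ENNReal.ofReal (2 * L) * ∫⁻ y, A y ∂μ := by
    have hm : Measurable fun p : ℝ × ℝ => A p.2 := by fun_prop
    rw [lintegral_prod _ hm.aemeasurable]
    simp only [lintegral_const, hmass]
    exact mul_comm _ _
  have hBp : ∫⁻ p : ℝ × ℝ, B p.1 ∂(μ.prod μ) = ENNReal.ofReal (2 * L) * ∫⁻ x, B x ∂μ := by
    have hm : Measurable fun p : ℝ × ℝ => B p.1 := by fun_prop
    rw [lintegral_prod_symm _ hm.aemeasurable]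
    simp only [lintegral_const, hmass]
    exact mul_comm _ _
  calc _ ≤ ∫⁻ q : ℝ × ℝ, ∫⁻ p : ℝ × ℝ, 2 * ENNReal.ofReal (2 * L) * (A p.2 + B q.1)
        ∂(μ.prod μ) ∂(μ.prod μ) := by
        refine lintegral_mono_ae (hae.mono fun q hq => ?_)
        exact lintegral_mono_ae (hae.mono fun p hp => hpt p hp q hq)
    _ = ∫⁻ q : ℝ × ℝ, 2 * ENNReal.ofReal (2 * L) * (ENNReal.ofReal (2 * L) * (∫⁻ y, A y ∂μ) +
          B q.1 * (ENNReal.ofReal (2 * L) * ENNReal.ofReal (2 * L))) ∂(μ.prod μ) := by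
        congr 1
        funext q
        rw [lintegral_const_mul _ (by fun_prop), lintegral_add_left (by fun_prop), hAp,
          lintegral_const, hmass2]
    _ = 2 * ENNReal.ofReal (2 * L) * (ENNReal.ofReal (2 * L) * ENNReal.ofReal (2 * L) *
          ENNReal.ofReal (2 * L)) * (∫⁻ y, A y ∂μ + ∫⁻ x, B x ∂μ) := by
        rw [lintegral_const_mul _ (by fun_prop), lintegral_add_left (by fun_prop),
          lintegral_const, hmass2, lintegral_mul_const _ (by fun_prop), hBp]
        ring
    _ = _ := by
        rw [hsum]
        congr 1
        rw [← ENNReal.ofReal_ofNat 2]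
        simp only [← ENNReal.ofReal_mul zero_le_two, ← ENNReal.ofReal_mul
          (show (0 : ℝ) ≤ 2 * L by positivity), ← ENNReal.ofReal_mul
          (show (0 : ℝ) ≤ 2 * L * (2 * L) by positivity), ← ENNReal.ofReal_mul
          (show (0 : ℝ) ≤ 2 * (2 * L) by positivity)]
        congr 1
        ring

/-! ### The Poincaré inequality for log-concave weights -/

/-- A drop of `log w` by `2` between `0` and `R • e` forces, by concavity, a slope of at most
`-2 / R` along the ray beyond `R • e`. -/
theorem exp_decay_of_concaveOn_log {w : EuclideanSpace ℝ (Fin 2) → ℝ} (hpos : ∀ z, 0 < w z)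
    (hlog : ConcaveOn ℝ Set.univ fun z => Real.log (w z)) {R : ℝ} (hR : 0 < R)
    {e : EuclideanSpace ℝ (Fin 2)} (he : w (R • e) ≤ w 0 * Real.exp (-2))
    {r s : ℝ} (hr : R ≤ r) (hs : r ≤ s) :
    w (s • e) ≤ w (r • e) * Real.exp (-(2 / R) * (s - r)) := by
  rcases hs.eq_or_lt with rfl | hs
  · simp
  have hr0 : 0 < r := hR.trans_le hr
  set φ : ℝ → ℝ := fun t => Real.log (w (t • e)) with hφ
  have hc : ConcaveOn ℝ Set.univ φ :=
    hlog.comp_linearMap (LinearMap.toSpanSingleton ℝ (EuclideanSpace ℝ (Fin 2)) e)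
  have h1 : φ R ≤ φ 0 - 2 := by
    have h := Real.log_le_log (hpos _) he
    rw [Real.log_mul (hpos _).ne' (Real.exp_ne_zero _), Real.log_exp] at h
    simp only [hφ, zero_smul]
    linarith
  have h2 : (1 - R / r) * φ 0 + R / r * φ r ≤ φ R := by
    have h := hc.2 (Set.mem_univ 0) (Set.mem_univ r)
      (sub_nonneg.2 ((div_le_one hr0).2 hr)) (show 0 ≤ R / r by positivity) (by ring)
    simp only [smul_eq_mul, mul_zero, zero_add, div_mul_cancel₀ _ hr0.ne'] at h
    exact h
  have h3 : (φ r - φ 0) / (r - 0) ≤ -(2 / R) := by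
    have h4 : R / r * (φ r - φ 0) ≤ -2 := by linarith
    rw [sub_zero, ← neg_div, le_div_iff₀ hR]
    calc _ = R / r * (φ r - φ 0) := by ring
      _ ≤ _ := h4
  have h5 := (hc.slope_anti_adjacent (Set.mem_univ 0) (Set.mem_univ s) hr0 hs).trans h3
  rw [div_le_iff₀ (sub_pos.2 hs)] at h5
  rw [← Real.log_le_log_iff (hpos _) (mul_pos (hpos _) (Real.exp_pos _)),
    Real.log_mul (hpos _).ne' (Real.exp_ne_zero _), Real.log_exp]
  simp only [hφ] at h5
  linarith

/-- A positive log-concave weight on the plane that tends to zero at infinity has a finite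
Poincaré constant. -/
theorem poincareConst_lt_top_of_concaveOn_log {w : EuclideanSpace ℝ (Fin 2) → ℝ}
    (hpos : ∀ z, 0 < w z) (hcont : Continuous w)
    (hlog : ConcaveOn ℝ Set.univ fun z => Real.log (w z))
    (hlim : Filter.Tendsto w (Filter.cocompact _) (nhds 0)) : poincareConst w w < ⊤ := by
  obtain ⟨R, hR, hdec⟩ : ∃ R : ℝ, 0 < R ∧ ∀ z, R ≤ ‖z‖ → w z ≤ w 0 * Real.exp (-2) := by
    have h := hlim.eventually_lt_const (mul_pos (hpos 0) (Real.exp_pos (-2)))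
    rw [← Metric.cobounded_eq_cocompact, ← comap_norm_atTop, Filter.eventually_comap,
      Filter.eventually_atTop] at h
    obtain ⟨a, ha⟩ := h
    exact ⟨max a 1, by positivity, fun z hz => (ha ‖z‖ ((le_max_left _ _).trans hz) z rfl).le⟩
  have hray : ∀ θ r s, R ≤ r → r ≤ s →
      w (s • unitVec θ) ≤ w (r • unitVec θ) * Real.exp (-(2 / R) * (s - r)) :=
    fun θ r s hr hs => exp_decay_of_concaveOn_log hpos hlog hR
      (hdec _ (by rw [norm_smul, norm_unitVec, mul_one]; exact le_abs_self R)) hr hs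
  -- On the square with half-side `2R`, which contains the disc of radius `2R`, the weight is
  -- comparable to a constant.
  set L := 2 * R
  have hL : 0 < L := by positivity
  set Q : Set (ℝ × ℝ) := Set.Icc (-L) L ×ˢ Set.Icc (-L) L with hQ
  have hQm : MeasurableSet Q := measurableSet_Icc.prod measurableSet_Icc
  have hQc : IsCompact Q := isCompact_Icc.prod isCompact_Icc
  have hQ0 : Q.Nonempty := ⟨(0, 0), by simp [hQ, hL.le]⟩
  have hwc : ContinuousOn (fun p => w (prodToPlane p)) Q :=
    (hcont.comp prodToPlane.continuous).continuousOn
  obtain ⟨pm, -, hpm⟩ := hQc.exists_isMinOn hQ0 hwc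
  obtain ⟨pM, -, hpM⟩ := hQc.exists_isMaxOn hQ0 hwc
  set m := w (prodToPlane pm)
  set M := w (prodToPlane pM)
  have hm0 : 0 < m := hpos _
  set μ : Measure ℝ := volume.restrict (Set.Icc (-L) L) with hμ
  have hμ2 : μ.prod μ = volume.restrict Q := by
    rw [hμ, Measure.prod_restrict, ← Measure.volume_eq_prod]
  set V := ENNReal.ofReal (2 * L) * ENNReal.ofReal (2 * L) with hV
  have hmass : (μ.prod μ) Set.univ = V := by
    rw [← Set.univ_prod_univ, Measure.prod_prod, hμ, Measure.restrict_apply_univ, Real.volume_Icc,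
      sub_neg_eq_add, ← two_mul]
  have hV0 : V ≠ 0 := by
    simp [hV, hL]
  have hVt : V ≠ ⊤ := ENNReal.mul_ne_top ENNReal.ofReal_ne_top ENNReal.ofReal_ne_top
  set K : ℝ≥0∞ := (3 * ENNReal.ofReal M * ENNReal.ofReal (32 * L ^ 4) * ENNReal.ofReal m⁻¹ +
    ENNReal.ofReal (8 * R ^ 2) * V) * V⁻¹ with hK
  have hKt : K ≠ ⊤ := by
    refine ENNReal.mul_ne_top (ENNReal.add_ne_top.2 ⟨?_, ?_⟩) (ENNReal.inv_ne_top.2 hV0)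
    · exact ENNReal.mul_ne_top (ENNReal.mul_ne_top (ENNReal.mul_ne_top (by simp)
        ENNReal.ofReal_ne_top) ENNReal.ofReal_ne_top) ENNReal.ofReal_ne_top
    · exact ENNReal.mul_ne_top ENNReal.ofReal_ne_top hVt
  have hineq : ∀ u : EuclideanSpace ℝ (Fin 2) → ℂ, IsSmoothBounded u →
      (⨅ c : ℂ, sqNormL2 w (fun x => u x - c)) ≤ K * sqNormGradL2 w u := by
    intro u hub
    have hu : ContDiff ℝ 1 u := hub.1.of_le (by exact_mod_cast le_top)
    have hmp := prodToPlane.continuous.measurable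
    have hmu : Measurable u := hu.continuous.measurable
    set D := sqNormGradL2 w u with hD
    set I := ⨅ c : ℂ, sqNormL2 w (fun x => u x - c)
    have hball (c : ℂ) :
        ∫⁻ z in Metric.closedBall 0 (2 * R), ‖u z - c‖ₑ ^ 2 * ENNReal.ofReal (w z) ≤
          ENNReal.ofReal M * ∫⁻ p, ‖u (prodToPlane p) - c‖ₑ ^ 2 ∂(μ.prod μ) := by
      rw [← lintegral_indicator Metric.isClosed_closedBall.measurableSet,
        ← lintegral_comp_prodToPlane, hμ2, ← lintegral_const_mul _ (by fun_prop),
        ← lintegral_indicator hQm]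
      refine lintegral_mono fun p => ?_
      by_cases hp : prodToPlane p ∈ Metric.closedBall (0 : EuclideanSpace ℝ (Fin 2)) (2 * R)
      · have hpQ : p ∈ Q := by
          rw [mem_closedBall_zero_iff] at hp
          have h1 := norm_prodToPlane_sq p
          have h2 : ‖prodToPlane p‖ ^ 2 ≤ L ^ 2 := by gcongr
          exact ⟨abs_le.1 (abs_le_of_sq_le_sq (by nlinarith [sq_nonneg p.2]) hL.le),
            abs_le.1 (abs_le_of_sq_le_sq (by nlinarith [sq_nonneg p.1]) hL.le)⟩
        rw [Set.indicator_of_mem hp, Set.indicator_of_mem hpQ, mul_comm]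
        gcongr
        exact hpM hpQ
      · rw [Set.indicator_of_notMem hp]
        exact zero_le
    have hgrad : ∫⁻ p, ∑ i, ‖partialDeriv i u (prodToPlane p)‖ₑ ^ 2 ∂(μ.prod μ) ≤
        ENNReal.ofReal m⁻¹ * D := by
      have hmd := measurable_enorm_partialDeriv hu
      have hmw : Measurable fun z => ENNReal.ofReal (w z) := hcont.measurable.ennreal_ofReal
      have hmg : Measurable fun z => (∑ i, ‖partialDeriv i u z‖ₑ ^ 2) * ENNReal.ofReal (w z) := by
        fun_prop
      rw [hD, sqNormGradL2, ← lintegral_const_mul _ hmg, ← lintegral_comp_prodToPlane, hμ2]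
      refine (setLIntegral_mono' hQm fun p hp => ?_).trans (setLIntegral_le_lintegral Q _)
      have h1 : 1 ≤ ENNReal.ofReal m⁻¹ * ENNReal.ofReal (w (prodToPlane p)) := by
        rw [← ENNReal.ofReal_mul (by positivity), ← ENNReal.ofReal_one]
        refine ENNReal.ofReal_le_ofReal ?_
        rw [inv_mul_eq_div, le_div_iff₀ hm0, one_mul]
        exact hpm hp
      calc _ = (∑ i, ‖partialDeriv i u (prodToPlane p)‖ₑ ^ 2) * 1 := (mul_one _).symm
        _ ≤ (∑ i, ‖partialDeriv i u (prodToPlane p)‖ₑ ^ 2) *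
            (ENNReal.ofReal m⁻¹ * ENNReal.ofReal (w (prodToPlane p))) := by gcongr
        _ = _ := by ring
    -- The infimum over `c` is at most the average over the values `c = u q` with `q` in the square.
    have hall (q : ℝ × ℝ) : I ≤ 3 * ENNReal.ofReal M *
        (∫⁻ p, ‖u (prodToPlane p) - u (prodToPlane q)‖ₑ ^ 2 ∂(μ.prod μ)) +
        ENNReal.ofReal (8 * R ^ 2) * D := by
      refine (iInf_le _ (u (prodToPlane q))).trans ?_
      refine (lintegral_sq_enorm_sub_mul_le hcont (fun z => (hpos z).le) hR hray hu _).trans ?_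
      rw [mul_assoc]
      gcongr
      exact hball _
    have hint := lintegral_mono (μ := μ.prod μ) hall
    have hmeas : Measurable fun q : ℝ × ℝ =>
        ∫⁻ p, ‖u (prodToPlane p) - u (prodToPlane q)‖ₑ ^ 2 ∂(μ.prod μ) := by
      refine Measurable.lintegral_prod_right' (f := fun x : (ℝ × ℝ) × (ℝ × ℝ) =>
        ‖u (prodToPlane x.2) - u (prodToPlane x.1)‖ₑ ^ 2) ?_
      fun_prop
    rw [lintegral_const, hmass, lintegral_add_left (hmeas.const_mul _), lintegral_const,
      lintegral_const_mul _ hmeas, hmass] at hint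
    calc I = I * V * V⁻¹ := by rw [mul_assoc, ENNReal.mul_inv_cancel hV0 hVt, mul_one]
      _ ≤ (3 * ENNReal.ofReal M * (ENNReal.ofReal (32 * L ^ 4) * (ENNReal.ofReal m⁻¹ * D)) +
          ENNReal.ofReal (8 * R ^ 2) * D * V) * V⁻¹ := by
        gcongr
        refine hint.trans ?_
        gcongr
        refine (lintegral_square_sq_enorm_sub_le hu hL hμ).trans ?_
        gcongr
      _ = _ := by rw [hK]; ring
  refine lt_of_le_of_lt (iInf₂_le (K.toNNReal + 1) ⟨by positivity, fun u hu => ?_⟩)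
    ENNReal.coe_lt_top
  refine (hineq u hu).trans ?_
  gcongr
  rw [ENNReal.coe_add, ENNReal.coe_toNNReal hKt]
  exact le_self_add

/-! ### Convolutions of log-concave functions -/

theorem continuous_of_concaveOn_log {f : EuclideanSpace ℝ (Fin 2) → ℝ} (hpos : ∀ z, 0 < f z)
    (hlog : ConcaveOn ℝ Set.univ fun z => Real.log (f z)) : Continuous f := by
  have h := (continuousOn_univ.1 (hlog.continuousOn isOpen_univ)).rexp
  simpa only [Real.exp_log (hpos _)] using h

theorem rpow_mul_rpow_le_of_concaveOn_log {E : Type*} [AddCommGroup E] [Module ℝ E] {f : E → ℝ}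
    (hpos : ∀ z, 0 < f z) (hlog : ConcaveOn ℝ Set.univ fun z => Real.log (f z)) {a b : ℝ}
    (ha : 0 ≤ a) (hb : 0 ≤ b) (hab : a + b = 1) (x y : E) :
    f x ^ a * f y ^ b ≤ f (a • x + b • y) := by
  have h := hlog.2 (Set.mem_univ x) (Set.mem_univ y) ha hb hab
  rw [← Real.exp_log (hpos (a • x + b • y)), Real.rpow_def_of_pos (hpos x),
    Real.rpow_def_of_pos (hpos y), ← Real.exp_add]
  refine Real.exp_le_exp.2 (le_trans (le_of_eq ?_) h)
  simp only [smul_eq_mul]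
  ring

theorem concaveOn_log_of_rpow_mul_rpow_le {E : Type*} [AddCommGroup E] [Module ℝ E] {f : E → ℝ}
    (hpos : ∀ z, 0 < f z) (h : ∀ a b : ℝ, 0 < a → 0 < b → a + b = 1 → ∀ x y : E,
      f x ^ a * f y ^ b ≤ f (a • x + b • y)) :
    ConcaveOn ℝ Set.univ fun z => Real.log (f z) := by
  rw [concaveOn_iff_forall_pos]
  refine ⟨convex_univ, fun x _ y _ a b ha hb hab => ?_⟩
  have h1 := Real.log_le_log (mul_pos (Real.rpow_pos_of_pos (hpos x) a)
    (Real.rpow_pos_of_pos (hpos y) b)) (h a b ha hb hab x y)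
  rwa [Real.log_mul (Real.rpow_pos_of_pos (hpos x) a).ne' (Real.rpow_pos_of_pos (hpos y) b).ne',
    Real.log_rpow (hpos x), Real.log_rpow (hpos y)] at h1

theorem convolution_mul_pos {f g : EuclideanSpace ℝ (Fin 2) → ℝ} (hf : ∀ z, 0 < f z)
    (hg : ∀ z, 0 < g z) (hfg : ConvolutionExists f g (ContinuousLinearMap.mul ℝ ℝ) volume)
    (z : EuclideanSpace ℝ (Fin 2)) :
    0 < (f ⋆[ContinuousLinearMap.mul ℝ ℝ, volume] g) z := by
  have hpos (t : EuclideanSpace ℝ (Fin 2)) : 0 < f t * g (z - t) := mul_pos (hf _) (hg _)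
  refine (integral_pos_iff_support_of_nonneg (fun t => (hpos t).le) (hfg z)).2 ?_
  have : (Function.support fun t => f t * g (z - t)) = Set.univ :=
    Set.eq_univ_of_forall fun t => (hpos t).ne'
  change 0 < volume (Function.support fun t => f t * g (z - t))
  rw [this]
  exact Measure.measure_univ_pos.2 (NeZero.ne _)

/-- The convolution of positive log-concave functions is log-concave, by the Prékopa–Leindler
inequality. -/
theorem concaveOn_log_convolution {f g : EuclideanSpace ℝ (Fin 2) → ℝ} (hf : ∀ z, 0 < f z)
    (hg : ∀ z, 0 < g z) (hflog : ConcaveOn ℝ Set.univ fun z => Real.log (f z))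
    (hglog : ConcaveOn ℝ Set.univ fun z => Real.log (g z))
    (hfg : ConvolutionExists f g (ContinuousLinearMap.mul ℝ ℝ) volume) :
    ConcaveOn ℝ Set.univ
      fun z => Real.log ((f ⋆[ContinuousLinearMap.mul ℝ ℝ, volume] g) z) := by
  refine concaveOn_log_of_rpow_mul_rpow_le (convolution_mul_pos hf hg hfg)
    fun a b ha hb hab x y => ?_
  have hfm := (continuous_of_concaveOn_log hf hflog).measurable
  have hgm := (continuous_of_concaveOn_log hg hglog).measurable
  have hpos (z t : EuclideanSpace ℝ (Fin 2)) : 0 < f t * g (z - t) := mul_pos (hf _) (hg _)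
  have hconv (z : EuclideanSpace ℝ (Fin 2)) :
      ENNReal.ofReal ((f ⋆[ContinuousLinearMap.mul ℝ ℝ, volume] g) z) =
        ∫⁻ t, ENNReal.ofReal (f t * g (z - t)) :=
    ofReal_integral_eq_lintegral_ofReal (hfg z)
      (Filter.Eventually.of_forall fun t => (hpos z t).le)
  have hPL := prekopa_leindler_plane (f := fun t => ENNReal.ofReal (f t * g (x - t)))
    (g := fun t => ENNReal.ofReal (f t * g (y - t)))
    (h := fun t => ENNReal.ofReal (f t * g (a • x + b • y - t))) ha hb hab
    (by fun_prop) (by fun_prop) (by fun_prop) fun s t => by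
      rw [ENNReal.ofReal_rpow_of_pos (hpos x s), ENNReal.ofReal_rpow_of_pos (hpos y t),
        ← ENNReal.ofReal_mul (Real.rpow_pos_of_pos (hpos x s) a).le]
      refine ENNReal.ofReal_le_ofReal ?_
      have h1 := rpow_mul_rpow_le_of_concaveOn_log hf hflog ha.le hb.le hab s t
      have h2 := rpow_mul_rpow_le_of_concaveOn_log hg hglog ha.le hb.le hab (x - s) (y - t)
      rw [show a • (x - s) + b • (y - t) = a • x + b • y - (a • s + b • t) by module] at h2
      rw [Real.mul_rpow (hf s).le (hg _).le, Real.mul_rpow (hf t).le (hg _).le]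
      calc _ = (f s ^ a * f t ^ b) * (g (x - s) ^ a * g (y - t) ^ b) := by ring
        _ ≤ _ := mul_le_mul h1 h2 (mul_pos (Real.rpow_pos_of_pos (hg _) a)
          (Real.rpow_pos_of_pos (hg _) b)).le (hf _).le
  have hW := convolution_mul_pos hf hg hfg
  rw [← hconv, ← hconv, ← hconv, ENNReal.ofReal_rpow_of_pos (hW x),
    ENNReal.ofReal_rpow_of_pos (hW y), ← ENNReal.ofReal_mul (Real.rpow_pos_of_pos (hW x) a).le,
    ENNReal.ofReal_le_ofReal_iff (hW _).le] at hPL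
  exact hPL

theorem convolutionExists_of_le {f g : EuclideanSpace ℝ (Fin 2) → ℝ} (hf : Continuous f)
    (hg : Integrable g) {B : ℝ} (hB : ∀ z, ‖f z‖ ≤ B) :
    ConvolutionExists f g (ContinuousLinearMap.mul ℝ ℝ) volume := fun z =>
  (hg.comp_sub_left z).bdd_mul hf.aestronglyMeasurable (Filter.Eventually.of_forall hB)

theorem convolution_mul_eq (f g : EuclideanSpace ℝ (Fin 2) → ℝ) (z : EuclideanSpace ℝ (Fin 2)) :
    (f ⋆[ContinuousLinearMap.mul ℝ ℝ, volume] g) z = ∫ t, f (z - t) * g t := by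
  rw [convolution_def, ← integral_sub_left_eq_self _ volume z]
  simp

theorem convolution_le {f g : EuclideanSpace ℝ (Fin 2) → ℝ} (hf0 : ∀ z, 0 ≤ f z)
    (hg : Integrable g) (hg0 : ∀ z, 0 ≤ g z) {B : ℝ} (hB : ∀ z, ‖f z‖ ≤ B)
    (z : EuclideanSpace ℝ (Fin 2)) :
    (f ⋆[ContinuousLinearMap.mul ℝ ℝ, volume] g) z ≤ B * ∫ t, g t := by
  rw [convolution_mul_eq, ← integral_const_mul]
  exact integral_mono_of_nonneg
    (Filter.Eventually.of_forall fun t => mul_nonneg (hf0 _) (hg0 t)) (hg.const_mul B)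
    (Filter.Eventually.of_forall fun t =>
      mul_le_mul_of_nonneg_right ((Real.le_norm_self _).trans (hB _)) (hg0 t))

/-- The convolution of an integrable function with a bounded continuous function that vanishes at
infinity vanishes at infinity. -/
theorem tendsto_convolution_cocompact {f g : EuclideanSpace ℝ (Fin 2) → ℝ} (hf : Continuous f)
    (hg : Integrable g) {B : ℝ} (hB : ∀ z, ‖f z‖ ≤ B)
    (hlim : Filter.Tendsto f (Filter.cocompact _) (nhds 0)) :
    Filter.Tendsto (f ⋆[ContinuousLinearMap.mul ℝ ℝ, volume] g) (Filter.cocompact _)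
      (nhds 0) := by
  have : (Filter.cocompact (EuclideanSpace ℝ (Fin 2))).IsCountablyGenerated := by
    rw [← Metric.cobounded_eq_cocompact, ← comap_norm_atTop]
    infer_instance
  simp only [funext (convolution_mul_eq f g)]
  have h := tendsto_integral_filter_of_dominated_convergence (μ := volume)
    (l := Filter.cocompact (EuclideanSpace ℝ (Fin 2)))
    (F := fun z t => f (z - t) * g t) (f := fun _ => 0) (fun t => B * ‖g t‖)
    (Filter.Eventually.of_forall fun z =>
      (hf.comp (continuous_const.sub continuous_id)).aestronglyMeasurable.mul
        hg.aestronglyMeasurable)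
    (Filter.Eventually.of_forall fun z => Filter.Eventually.of_forall fun t => by
      rw [norm_mul]
      gcongr
      exact hB _)
    (hg.norm.const_mul B)
    (Filter.Eventually.of_forall fun t => by
      have h1 : Filter.Tendsto (fun z => z - t)
          (Filter.cocompact (EuclideanSpace ℝ (Fin 2))) (Filter.cocompact _) :=
        (Homeomorph.subRight t).isClosedEmbedding.tendsto_cocompact
      simpa using (hlim.comp h1).mul_const (g t))
  simpa using h

/-! ### The spectrogram as a log-concave function on the plane -/

theorem spectrogram_expWindow_pos (z : EuclideanSpace ℝ (Fin 2)) :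
    0 < sqModulus (stft expWindow expWindow) z := by
  rw [sqModulus_stft_expWindow]
  exact mul_pos (timeProfile_pos _) (gammaProfile_pos _)

theorem concaveOn_log_spectrogram_expWindow : ConcaveOn ℝ Set.univ
    fun z => Real.log (sqModulus (stft expWindow expWindow) z) := by
  have heq : (fun z => Real.log (sqModulus (stft expWindow expWindow) z)) =
      (fun z => Real.log (timeProfile (z 0))) +
        fun z => Real.log (gammaProfile (-2 * Real.pi * z 1)) := by
    funext z
    rw [sqModulus_stft_expWindow, Real.log_mul (timeProfile_pos _).ne' (gammaProfile_pos _).ne']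
    rfl
  rw [heq]
  have hproj (i : Fin 2) (c : ℝ) : ∃ l : EuclideanSpace ℝ (Fin 2) →ₗ[ℝ] ℝ, ∀ z, l z = c * z i :=
    ⟨c • (EuclideanSpace.proj i : EuclideanSpace ℝ (Fin 2) →L[ℝ] ℝ).toLinearMap, fun z => rfl⟩
  obtain ⟨l₀, h₀⟩ := hproj 0 1
  obtain ⟨l₁, h₁⟩ := hproj 1 (-2 * Real.pi)
  refine ConcaveOn.add ?_ ?_
  · simpa [Function.comp_def, h₀] using concaveOn_log_timeProfile.comp_linearMap l₀
  · simpa [Function.comp_def, h₁] using concaveOn_log_gammaProfile.comp_linearMap l₁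

theorem spectrogram_expWindow_le_mul (z : EuclideanSpace ℝ (Fin 2)) :
    sqModulus (stft expWindow expWindow) z ≤ (1 + z 0 ^ 2)⁻¹ * (4 * (1 + z 1 ^ 2)⁻¹) := by
  rw [sqModulus_stft_expWindow]
  refine mul_le_mul (timeProfile_le _) ((gammaProfile_le _).trans ?_) (gammaProfile_pos _).le
    (by positivity)
  have h1 : 0 ≤ 4 * Real.pi ^ 2 - 1 := by nlinarith [Real.pi_gt_three]
  have h2 : z 1 ^ 2 ≤ (-2 * Real.pi * z 1) ^ 2 := by
    nlinarith [mul_nonneg (sq_nonneg (z 1)) h1]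
  gcongr

theorem spectrogram_expWindow_le (z : EuclideanSpace ℝ (Fin 2)) :
    sqModulus (stft expWindow expWindow) z ≤ 4 * (1 + ‖z‖ ^ 2)⁻¹ := by
  refine (spectrogram_expWindow_le_mul z).trans ?_
  rw [mul_left_comm, ← mul_inv, EuclideanSpace.norm_sq_eq, Fin.sum_univ_two]
  simp only [Real.norm_eq_abs, sq_abs]
  gcongr
  nlinarith [mul_nonneg (sq_nonneg (z 0)) (sq_nonneg (z 1))]

theorem norm_spectrogram_expWindow_le (z : EuclideanSpace ℝ (Fin 2)) :
    ‖sqModulus (stft expWindow expWindow) z‖ ≤ 4 := by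
  rw [Real.norm_of_nonneg (spectrogram_expWindow_pos z).le]
  refine (spectrogram_expWindow_le z).trans ?_
  have : (1 + ‖z‖ ^ 2)⁻¹ ≤ 1 := inv_le_one_of_one_le₀ (by nlinarith [sq_nonneg ‖z‖])
  linarith

theorem continuous_spectrogram_expWindow : Continuous (sqModulus (stft expWindow expWindow)) :=
  continuous_of_concaveOn_log spectrogram_expWindow_pos concaveOn_log_spectrogram_expWindow

theorem integrable_spectrogram_expWindow :
    Integrable (sqModulus (stft expWindow expWindow)) := by
  rw [← measurePreserving_prodToPlane.integrable_comp_emb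
    prodToPlane.toHomeomorph.measurableEmbedding]
  have h := integrable_inv_one_add_sq.mul_prod (integrable_inv_one_add_sq.const_mul 4)
  refine h.mono' (continuous_spectrogram_expWindow.comp
    prodToPlane.continuous).aestronglyMeasurable (Filter.Eventually.of_forall fun p => ?_)
  rw [Function.comp_apply, Real.norm_of_nonneg (spectrogram_expWindow_pos _).le]
  exact spectrogram_expWindow_le_mul (prodToPlane p)

theorem tendsto_spectrogram_expWindow_cocompact :
    Filter.Tendsto (sqModulus (stft expWindow expWindow)) (Filter.cocompact _) (nhds 0) := by
  have h : Filter.Tendsto (fun z : EuclideanSpace ℝ (Fin 2) => 4 * (1 + ‖z‖ ^ 2)⁻¹)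
      (Filter.cocompact _) (nhds 0) := by
    have h1 : Filter.Tendsto (fun r : ℝ => 4 * (1 + r ^ 2)⁻¹) Filter.atTop (nhds 0) := by
      simpa using ((Filter.tendsto_atTop_add_const_left _ 1
        (Filter.tendsto_pow_atTop two_ne_zero)).inv_tendsto_atTop).const_mul (4 : ℝ)
    exact h1.comp (tendsto_norm_cocompact_atTop)
  exact squeeze_zero (fun z => (spectrogram_expWindow_pos z).le) spectrogram_expWindow_le h

theorem theorem1p13 (γ : EuclideanSpace ℝ (Fin 2) → ℝ)
    (hγ_pos : ∀ z, 0 < γ z) (hγ_int : Integrable γ) (hγ_log : IsLogConcave γ) :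
    -- the convolution is a convergent integral at every point
    ConvolutionExists (sqModulus (stft expWindow expWindow)) γ
      (ContinuousLinearMap.mul ℝ ℝ) volume ∧
    -- `w` is a positive integrable weight
    (∀ z, 0 < smoothedWeight (stft expWindow expWindow) γ z) ∧
    Integrable (smoothedWeight (stft expWindow expWindow) γ) ∧
    IsLogConcave (smoothedWeight (stft expWindow expWindow) γ) ∧
    poincareConst (smoothedWeight (stft expWindow expWindow) γ)
      (smoothedWeight (stft expWindow expWindow) γ) < ⊤ := by
  have hγlog : ConcaveOn ℝ Set.univ fun z => Real.log (γ z) := by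
    have h := hγ_log.2
    rwa [show {x | 0 < γ x} = Set.univ from Set.eq_univ_of_forall hγ_pos] at h
  have hFc := continuous_spectrogram_expWindow
  have hFB := norm_spectrogram_expWindow_le
  have hex := convolutionExists_of_le hFc hγ_int hFB
  set W := sqModulus (stft expWindow expWindow) ⋆[ContinuousLinearMap.mul ℝ ℝ, volume] γ
  have hw : smoothedWeight (stft expWindow expWindow) γ = fun z => W z ^ 2 := rfl
  have hWpos : ∀ z, 0 < W z := convolution_mul_pos spectrogram_expWindow_pos hγ_pos hex
  have hWlog : ConcaveOn ℝ Set.univ fun z => Real.log (W z) := concaveOn_log_convolution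
    spectrogram_expWindow_pos hγ_pos concaveOn_log_spectrogram_expWindow hγlog hex
  have hWc : Continuous W := continuous_of_concaveOn_log hWpos hWlog
  have hWint : Integrable W :=
    integrable_spectrogram_expWindow.integrable_convolution (ContinuousLinearMap.mul ℝ ℝ) hγ_int
  have hWlim : Filter.Tendsto W (Filter.cocompact _) (nhds 0) :=
    tendsto_convolution_cocompact hFc hγ_int hFB tendsto_spectrogram_expWindow_cocompact
  have hpos (z) : 0 < W z ^ 2 := pow_pos (hWpos z) 2
  have hlog : ConcaveOn ℝ Set.univ fun z => Real.log (W z ^ 2) := by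
    simpa [Real.log_pow] using hWlog.smul (zero_le_two (α := ℝ))
  rw [hw]
  refine ⟨hex, hpos, ?_, ⟨fun z => (hpos z).le, ?_⟩,
    poincareConst_lt_top_of_concaveOn_log hpos (hWc.pow 2) hlog ?_⟩
  · have h := hWint.bdd_mul hWc.aestronglyMeasurable (c := 4 * ∫ t, γ t)
      (Filter.Eventually.of_forall fun z => by
        rw [Real.norm_of_nonneg (hWpos z).le]
        exact convolution_le (fun z => (spectrogram_expWindow_pos z).le) hγ_int
          (fun t => (hγ_pos t).le) hFB z)
    simpa only [pow_two] using h
  · rwa [show {z | 0 < W z ^ 2} = Set.univ from Set.eq_univ_of_forall hpos]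
  · simpa using hWlim.pow 2
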